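/- Let $n,l,J\ge 0$ be integers, let $m_1,\dots,m_J\ge 1$ be integers and $m=\sum_{i=1}^J m_i$, let $\mathcal K_i=\{(x_1,x_2)\in\mathbb R\times\mathbb R^{m_i-1}: x_1\ge\|x_2\|\}$ be the $m_i$-dimensional second-order cone, and let $\mathcal K=\mathcal K_1\times\dots\times\mathcal K_J\subseteq\mathbb R^m$. Let $\Lambda\subseteq\mathbb R^l$ be closed and let $F:\mathbb R^n\to\mathbb R^l$ and $G=(G_1,\dots,G_J),\ H=(H_1,\dots,H_J):\mathbb R^n\to\mathbb R^m=\mathbb R^{m_1}\times\dots\times\mathbb R^{m_J}$ be continuously differentiable. Let $\mathcal F$ be the set of all $z\in\mathbb R^n$ with $$\mathcal K\ni G(z)\perp H(z)\in\mathcal K,\qquad F(z)\in\Lambda. \tag{1}$$ Put $\Omega=\{(x,y):\mathcal K\ni x\perp y\in\mathcal K\}$ and $\Omega_i=\{(x,y):\mathcal K_i\ni x\perp y\in\mathcal K_i\}$. All spaces carry Euclidean norms, and $d_C$ and $d(\cdot,C)$ denote the Euclidean distance to $C$. For a set $C$ in a Euclidean space, $z\in C$ and a direction $d$, let $T_C(z)=\{u:\exists\,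 t_k\downarrow 0,\ u_k\to u,\ z+t_ku_k\in C\ \forall k\}$; for $z\in C$ let $\widehat N_C(z)=\{v:\langle v,z'-z\rangle\le o(\|z'-z\|)\ \text{for } z'\in C\}$, and for $z\notin C$ let $\widehat N_C(z)=\emptyset$; and let $N_C(z;d)=\{v:\exists\, t_k\downarrow 0,\ d_k\to d,\ v_k\to v,\ v_k\in\widehat N_C(z+t_kd_k)\ \forall k\}$. Let $z^*\in\mathcal F$. Consider the following two conditions. (A) For every $0\ne w\in\mathbb R^n$ with $\nabla F(z^*)w\in T_\Lambda(F(z^*))$ and $(\nabla G_i(z^*)w,\nabla H_i(z^*)w)\in T_{\Omega_i}(G_i(z^*),H_i(z^*))$ for $i=1,\dots,J$: whenever $\lambda^F\in\mathbb R^l$ and $\lambda^G,\lambda^H\in\mathbb R^m$ satisfy $$\nabla F(z^*)^T\lambda^F+\sum_{i=1}^J\{\nabla G_i(z^*)^T\lambda_i^G+\nabla H_i(z^*)^T\lambda_i^H\}=0,\quad \lambda^F\in N_\Lambda(F(z^*);\nabla F(z^*)w),$$ $$(\lambda_i^G,\lambda_i^H)\in N_{\Omega_i}\big((G_i(z^*),H_i(z^*));(\nabla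 G_i(z^*)w,\nabla H_i(z^*)w)\big),\quad i=1,\dots,J,$$ one has $(\lambda^G,\lambda^H)=0$. (B) For every $0\ne w\in\mathbb R^n$ with $\nabla F(z^*)w\in T_\Lambda(F(z^*))$ and $(\nabla G(z^*)w,\nabla H(z^*)w)\in T_\Omega(G(z^*),H(z^*))$: whenever $\lambda^F\in\mathbb R^l$ and $\lambda^G,\lambda^H\in\mathbb R^m$ satisfy $$\nabla F(z^*)^T\lambda^F+\nabla G(z^*)^T\lambda^G+\nabla H(z^*)^T\lambda^H=0,\quad \lambda^F\in N_\Lambda(F(z^*);\nabla F(z^*)w),$$ $$(\lambda^G,\lambda^H)\in N_\Omega\big((G(z^*),H(z^*));(\nabla G(z^*)w,\nabla H(z^*)w)\big),$$ one has $(\lambda^G,\lambda^H)=0$. Then (A) and (B) are equivalent. Moreover, suppose that (A) (equivalently, (B)) holds and that the set-valued mapping $M(z)=F(z)-\Lambda$ is metrically subregular at $(z^*,0)$, that is, there are $\kappa>0$ and a neighborhood $V$ of $z^*$ with $d(z,F^{-1}(\Lambda))\le\kappa\, d_\Lambda(F(z))$ for all $z\in V$. Then the system (1) has a local error bound at $z^*$: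 there are $\kappa>0$ and a neighborhood $U$ of $z^*$ such that $$d(z,\mathcal F)\le\kappa\Big\{d_\Lambda(F(z))+\sum_{i=1}^J d_{\Omega_i}(G_i(z),H_i(z))\Big\}\qquad\forall z\in U.$$ -/

import Mathlib

open Filter Topology

namespace SOCCP

/-! ### Variational analysis -/

section VariationalAnalysis

variable {E : Type*} [NormedAddCommGroup E] [InnerProductSpace ℝ E]

/-- The (Bouligand) tangent cone `T_C(z)`: all limits `u` of sequences `u k` such that
`z + t k • u k ∈ C` for some positive step sizes `t k → 0`. -/
def tangentCone (C : Set E) (z : E) : Set E :=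
  {u | ∃ (t : ℕ → ℝ) (uk : ℕ → E), (∀ k, 0 < t k) ∧ Tendsto t atTop (𝓝 0) ∧
    Tendsto uk atTop (𝓝 u) ∧ ∀ k, z + t k • uk k ∈ C}

/-- The regular (Fréchet) normal cone to `C` at `z`: all `v` such that
`⟪v, z' - z⟫ ≤ o(‖z' - z‖)` for `z' ∈ C`. It is empty when `z ∉ C`. -/
def regularNormalCone (C : Set E) (z : E) : Set E :=
  {v | z ∈ C ∧ ∀ ε > 0, ∀ᶠ z' in 𝓝[C] z, inner ℝ v (z' - z) ≤ ε * ‖z' - z‖}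

/-- The limiting normal cone `N_C(z; d)` to `C` at `z` in direction `d`: all limits of
`v k ∈ regularNormalCone C (z + t k • dk k)` with `t k ↓ 0` and `dk k → d`. -/
def directionalNormalCone (C : Set E) (z d : E) : Set E :=
  {v | ∃ (t : ℕ → ℝ) (dk vk : ℕ → E), (∀ k, 0 < t k) ∧ Tendsto t atTop (𝓝 0) ∧
    Tendsto dk atTop (𝓝 d) ∧ Tendsto vk atTop (𝓝 v) ∧
    ∀ k, vk k ∈ regularNormalCone C (z + t k • dk k)}

/-- The set-valued mapping `z ↦ P z - D` is metrically subregular at `(z, 0)`: the point `(z, 0)`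
lies in its graph, and near `z` the distance to the solution set of `P z' ∈ D` is bounded by a
constant multiple of the distance from `P z'` to `D`. -/
def MetricallySubregularAt {X Y : Type*} [PseudoMetricSpace X] [PseudoMetricSpace Y]
    (P : X → Y) (D : Set Y) (z : X) : Prop :=
  P z ∈ D ∧ ∃ κ > 0, ∀ᶠ z' in 𝓝 z,
    Metric.infDist z' {u | P u ∈ D} ≤ κ * Metric.infDist (P z') D

/-- The complementarity set `{(x, y) | K ∋ x ⊥ y ∈ K}` of `K`, in the Euclidean product. -/
def complementaritySet (K : Set E) : Set (WithLp 2 (E × E)) :=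
  {p | p.fst ∈ K ∧ p.snd ∈ K ∧ inner ℝ p.fst p.snd = 0}

end VariationalAnalysis

/-! ### Second-order cones -/

/-- The Euclidean space `ℝ × ℝ^r`, of dimension `r + 1`, containing the `(r + 1)`-dimensional
second-order cone. -/
abbrev Block (r : ℕ) : Type := WithLp 2 (ℝ × EuclideanSpace ℝ (Fin r))

/-- The `(r + 1)`-dimensional second-order (Lorentz) cone `{(x₁, x₂) | x₁ ≥ ‖x₂‖}`. -/
def secondOrderCone (r : ℕ) : Set (Block r) :=
  {x | ‖x.snd‖ ≤ x.fst}

/-- The Euclidean space `ℝ^m`, `m = ∑ i, (r i + 1)`, split into `J` blocks. -/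
abbrev BlockSpace {J : ℕ} (r : Fin J → ℕ) : Type := PiLp 2 (fun i => Block (r i))

/-- The Cartesian product of the second-order cones of dimensions `r i + 1`. -/
def productCone {J : ℕ} (r : Fin J → ℕ) : Set (BlockSpace r) :=
  {x | ∀ i, x i ∈ secondOrderCone (r i)}

/-! ### The second-order cone complementarity problem -/

section Problem

variable {n l J : ℕ} {r : Fin J → ℕ}

/-- The solution set of the system `K ∋ G z ⊥ H z ∈ K`, `F z ∈ Λ`, where `K` is the product of
the second-order cones of dimensions `r i + 1`. -/
def solutionSet (G H : EuclideanSpace ℝ (Fin n) → BlockSpace r)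
    (F : EuclideanSpace ℝ (Fin n) → EuclideanSpace ℝ (Fin l))
    (Lam : Set (EuclideanSpace ℝ (Fin l))) : Set (EuclideanSpace ℝ (Fin n)) :=
  {z | G z ∈ productCone r ∧ H z ∈ productCone r ∧ inner ℝ (G z) (H z) = 0 ∧ F z ∈ Lam}

/-- The system has a local error bound at its solution `zs`: near `zs`, the distance to the
solution set is at most `κ (d_Λ(F z) + ∑ i, d_{Ω_i}(G_i z, H_i z))`. -/
def HasLocalErrorBoundAt (G H : EuclideanSpace ℝ (Fin n) → BlockSpace r)
    (F : EuclideanSpace ℝ (Fin n) → EuclideanSpace ℝ (Fin l))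
    (Lam : Set (EuclideanSpace ℝ (Fin l))) (zs : EuclideanSpace ℝ (Fin n)) : Prop :=
  zs ∈ solutionSet G H F Lam ∧ ∃ κ > 0, ∀ᶠ z in 𝓝 zs,
    Metric.infDist z (solutionSet G H F Lam) ≤
      κ * (Metric.infDist (F z) Lam +
        ∑ i, Metric.infDist (WithLp.toLp 2 (G z i, H z i))
          (complementaritySet (secondOrderCone (r i))))

/-- The directional multiplier condition at `zs`, stated block by block. -/
def ComponentwiseMultiplierCondition (G H : EuclideanSpace ℝ (Fin n) → BlockSpace r)
    (F : EuclideanSpace ℝ (Fin n) → EuclideanSpace ℝ (Fin l))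
    (Lam : Set (EuclideanSpace ℝ (Fin l))) (zs : EuclideanSpace ℝ (Fin n)) : Prop :=
  ∀ w : EuclideanSpace ℝ (Fin n), w ≠ 0 →
    fderiv ℝ F zs w ∈ tangentCone Lam (F zs) →
    (∀ i, WithLp.toLp 2 (fderiv ℝ (fun z => G z i) zs w, fderiv ℝ (fun z => H z i) zs w) ∈
      tangentCone (complementaritySet (secondOrderCone (r i)))
        (WithLp.toLp 2 (G zs i, H zs i))) →
    ∀ (lamF : EuclideanSpace ℝ (Fin l)) (lamG lamH : BlockSpace r),
      (fderiv ℝ F zs).adjoint lamF +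
        ∑ i, ((fderiv ℝ (fun z => G z i) zs).adjoint (lamG i) +
          (fderiv ℝ (fun z => H z i) zs).adjoint (lamH i)) = 0 →
      lamF ∈ directionalNormalCone Lam (F zs) (fderiv ℝ F zs w) →
      (∀ i, WithLp.toLp 2 (lamG i, lamH i) ∈
        directionalNormalCone (complementaritySet (secondOrderCone (r i)))
          (WithLp.toLp 2 (G zs i, H zs i))
          (WithLp.toLp 2
            (fderiv ℝ (fun z => G z i) zs w, fderiv ℝ (fun z => H z i) zs w))) →
      lamG = 0 ∧ lamH = 0

/-- The directional multiplier condition at `zs`, stated for the product cone. -/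
def JointMultiplierCondition (G H : EuclideanSpace ℝ (Fin n) → BlockSpace r)
    (F : EuclideanSpace ℝ (Fin n) → EuclideanSpace ℝ (Fin l))
    (Lam : Set (EuclideanSpace ℝ (Fin l))) (zs : EuclideanSpace ℝ (Fin n)) : Prop :=
  ∀ w : EuclideanSpace ℝ (Fin n), w ≠ 0 →
    fderiv ℝ F zs w ∈ tangentCone Lam (F zs) →
    WithLp.toLp 2 (fderiv ℝ G zs w, fderiv ℝ H zs w) ∈
      tangentCone (complementaritySet (productCone r)) (WithLp.toLp 2 (G zs, H zs)) →
    ∀ (lamF : EuclideanSpace ℝ (Fin l)) (lamG lamH : BlockSpace r),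
      (fderiv ℝ F zs).adjoint lamF + (fderiv ℝ G zs).adjoint lamG +
        (fderiv ℝ H zs).adjoint lamH = 0 →
      lamF ∈ directionalNormalCone Lam (F zs) (fderiv ℝ F zs w) →
      WithLp.toLp 2 (lamG, lamH) ∈
        directionalNormalCone (complementaritySet (productCone r))
          (WithLp.toLp 2 (G zs, H zs))
          (WithLp.toLp 2 (fderiv ℝ G zs w, fderiv ℝ H zs w)) →
      lamG = 0 ∧ lamH = 0

end Problem

end SOCCP

/-! Equivalence. Everything reduces to product formulas for `tangentCone` and
`directionalNormalCone` of Ω. One inclusion is immediate. The other fails for general closed sets,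
because the step sizes realizing a directional normal may differ from block to block. Here each Ω_i
is, near each of its points and after a C¹ change of coordinates, a cone with apex at that point
(`hasConicChartAt_complementaritySet`). Regular normals to a cone do not change along rays from the
apex, so every directional normal is attained along any prescribed step sizes
(`HasConicChartAt.directionallyUniformAt`), and all blocks can share the steps 1/(k+1). Tangent
directions are those admitting zero as a directional normal, so the same formula covers them.

Error bound. Write P = (G, H) and suppose the bound fails. Minimizing d_Ω(P x) + K d_Λ(F x) + ε‖x -
z‖ over a compact ball, for a badly behaved z near z*, gives a point u. Subregularity of F and a
large K force F u ∈ Λ (exact penalization), while u stays too close to z to be feasible, so P u ∉ Ω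
(`exists_penalized_min_of_not_errorBound`). Smoothing both distances gives approximate multipliers
at u: a unit regular normal to Ω and a regular normal to Λ of norm at most K. Their base points lie
within ε‖u - z*‖ of P u and F u, so as ε → 0 the normalized directions (u - z*)/‖u - z*‖ and the
multipliers subconverge to a critical direction and directional normals with nonzero Ω-part. This
contradicts the multiplier condition. -/

namespace SOCCP

/-! ### Regular and directional normals; sets that are locally conic in a chart -/

section NormalCones

variable {X Y : Type*} [NormedAddCommGroup X] [InnerProductSpace ℝ X]
  [NormedAddCommGroup Y] [InnerProductSpace ℝ Y]

theorem regularNormalCone_smul {C : Set X} {z v : X} (hv : v ∈ regularNormalCone C z)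
    {c : ℝ} (hc : 0 < c) : c • v ∈ regularNormalCone C z := by
  refine ⟨hv.1, fun ε hε => ?_⟩
  filter_upwards [hv.2 (ε / c) (div_pos hε hc)] with z' hz'
  rw [inner_smul_left]
  calc c * inner ℝ v (z' - z) ≤ c * (ε / c * ‖z' - z‖) := by gcongr
    _ = ε * ‖z' - z‖ := by field_simp

theorem zero_mem_regularNormalCone_iff {C : Set X} {z : X} :
    (0 : X) ∈ regularNormalCone C z ↔ z ∈ C := by
  refine ⟨fun h => h.1, fun h => ⟨h, fun ε hε => Eventually.of_forall fun z' => ?_⟩⟩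
  rw [inner_zero_left]
  positivity

/-- A direction is tangent exactly when the zero vector is a limiting normal in it. -/
theorem mem_tangentCone_iff_zero_mem_directionalNormalCone {C : Set X} {z d : X} :
    d ∈ tangentCone C z ↔ (0 : X) ∈ directionalNormalCone C z d := by
  constructor
  · rintro ⟨t, dk, ht, ht0, hdk, hC⟩
    exact ⟨t, dk, fun _ => 0, ht, ht0, hdk, tendsto_const_nhds, fun k =>
      zero_mem_regularNormalCone_iff.2 (hC k)⟩
  · rintro ⟨t, dk, vk, ht, ht0, hdk, -, hC⟩
    exact ⟨t, dk, ht, ht0, hdk, fun k => (hC k).1⟩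

/-- Regular normals pull back along a map differentiable at the point. -/
theorem adjoint_mem_regularNormalCone [CompleteSpace X] [CompleteSpace Y] {C : Set X} {D : Set Y}
    {ψ : X → Y} {A : X →L[ℝ] Y} {x : X} {w : Y} (hψ : HasFDerivAt ψ A x) (hx : x ∈ C)
    (hmap : ∀ᶠ x' in 𝓝 x, x' ∈ C → ψ x' ∈ D) (hw : w ∈ regularNormalCone D (ψ x)) :
    A.adjoint w ∈ regularNormalCone C x := by
  refine ⟨hx, fun ε hε => ?_⟩
  -- Half of ε pays for the remainder of `ψ` paired with `w`, half for the normality of `w`. The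
  -- bound `h1` makes `‖A‖ + 1` a Lipschitz constant of `ψ` at `x`; the summands 1 keep the
  -- denominators positive.
  have hc : 0 < ε / (2 * (‖w‖ + 1)) := by positivity
  have h1 := hψ.isLittleO.def one_pos
  have h2 := hψ.isLittleO.def hc
  have hK : 0 < ‖A‖ + 1 := by positivity
  have ht : Tendsto ψ (𝓝[C] x) (𝓝[D] (ψ x)) :=
    tendsto_nhdsWithin_iff.2 ⟨hψ.continuousAt.tendsto.mono_left nhdsWithin_le_nhds, by
      filter_upwards [nhdsWithin_le_nhds hmap, self_mem_nhdsWithin] with x' h h' using h h'⟩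
  filter_upwards [nhdsWithin_le_nhds h1, nhdsWithin_le_nhds h2,
    ht.eventually (hw.2 (ε / (2 * (‖A‖ + 1))) (by positivity))] with x' h1 h2 h3
  rw [ContinuousLinearMap.adjoint_inner_left]
  have e : A (x' - x) = (ψ x' - ψ x) - (ψ x' - ψ x - A (x' - x)) := by abel
  have b1 : ‖ψ x' - ψ x‖ ≤ (‖A‖ + 1) * ‖x' - x‖ := by
    have : ψ x' - ψ x = (ψ x' - ψ x - A (x' - x)) + A (x' - x) := by abel
    rw [this]
    refine (norm_add_le _ _).trans ?_
    have := A.le_opNorm (x' - x)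
    linarith
  have b2 : -(‖w‖ * ‖ψ x' - ψ x - A (x' - x)‖) ≤ inner ℝ w (ψ x' - ψ x - A (x' - x)) :=
    (abs_le.1 (abs_real_inner_le_norm _ _)).1
  rw [e, inner_sub_right]
  have b3 : ε / (2 * (‖A‖ + 1)) * ‖ψ x' - ψ x‖ ≤ ε / 2 * ‖x' - x‖ := by
    calc _ ≤ ε / (2 * (‖A‖ + 1)) * ((‖A‖ + 1) * ‖x' - x‖) := by gcongr
      _ = _ := by field_simp
  have b4 : ‖w‖ * ‖ψ x' - ψ x - A (x' - x)‖ ≤ ε / 2 * ‖x' - x‖ := by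
    calc _ ≤ (‖w‖ + 1) * (ε / (2 * (‖w‖ + 1)) * ‖x' - x‖) := by gcongr; linarith
      _ = _ := by field_simp
  linarith

/-- Every limiting normal in a direction is attained along every sequence of step sizes. -/
def DirectionallyUniformAt (C : Set X) (z : X) : Prop :=
  ∀ d v, v ∈ directionalNormalCone C z d → ∀ s : ℕ → ℝ, (∀ k, 0 < s k) → Tendsto s atTop (𝓝 0) →
    ∃ dk vk : ℕ → X, Tendsto dk atTop (𝓝 d) ∧ Tendsto vk atTop (𝓝 v) ∧
      ∀ᶠ k in atTop, vk k ∈ regularNormalCone C (z + s k • dk k)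

/-- Near `p`, the set `D` is a cone with apex `p`. -/
def LocallyConicAt (D : Set X) (p : X) : Prop :=
  ∃ ε > 0, ∀ u : X, ‖u‖ < ε → ∀ t : ℝ, 0 < t → t ≤ 1 → (p + u ∈ D ↔ p + t • u ∈ D)

/-- The homothety about `p` with ratio `t / s` preserves `D` near `p` and takes one point to the
other. Its adjoint only multiplies normals by `t / s`, a positive factor that can be divided out. -/
theorem LocallyConicAt.exists_regularNormalCone_congr [CompleteSpace X] {D : Set X} {p : X}
    (h : LocallyConicAt D p) : ∃ ε > 0, ∀ (u : X) (t s : ℝ), 0 < t → 0 < s → ‖t • u‖ < ε →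
      ‖s • u‖ < ε → ∀ v ∈ regularNormalCone D (p + t • u), v ∈ regularNormalCone D (p + s • u) := by
  obtain ⟨ε, hε, h⟩ := h
  have key : ∀ (u : X) (c : ℝ), 0 < c → ‖u‖ < ε → ‖c • u‖ < ε → (p + u ∈ D ↔ p + c • u ∈ D) := by
    intro u c hc hu hcu
    rcases le_total c 1 with h1 | h1
    · exact h u hu c hc h1
    -- An expansion by `c` is a contraction by `c⁻¹` read backwards.
    · have := h (c • u) hcu c⁻¹ (inv_pos.2 hc) (inv_le_one_of_one_le₀ h1)
      rw [smul_smul, inv_mul_cancel₀ hc.ne', one_smul] at this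
      exact this.symm
  refine ⟨ε, hε, fun u t s ht hs htu hsu v hv => ?_⟩
  set c : ℝ := t / s with hc
  have hc0 : 0 < c := div_pos ht hs
  have hcs : c • s • u = t • u := by rw [smul_smul, hc, div_mul_cancel₀ _ hs.ne']
  let ψ : X → X := fun x => p + c • (x - p)
  have hψ : HasFDerivAt ψ (c • ContinuousLinearMap.id ℝ X) (p + s • u) :=
    (((hasFDerivAt_id (p + s • u)).sub_const p).const_smul c).const_add p
  have hψx : ψ (p + s • u) = p + t • u := by simp [ψ, hcs]
  have hb : ∀ᶠ x' in 𝓝 (p + s • u), ‖x' - p‖ < ε ∧ ‖c • (x' - p)‖ < ε := by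
    refine Filter.Eventually.and ?_ ?_
    · refine (show ContinuousAt (fun x' => ‖x' - p‖) (p + s • u) by fun_prop).eventually_lt_const ?_
      simpa using hsu
    · refine (show ContinuousAt (fun x' => ‖c • (x' - p)‖) (p + s • u) by
        fun_prop).eventually_lt_const ?_
      simpa only [add_sub_cancel_left, hcs] using htu
  have hmem : p + s • u ∈ D := by
    have := hv.1
    rw [← hcs] at this
    exact (key (s • u) c hc0 hsu (by rwa [hcs])).2 this
  have := adjoint_mem_regularNormalCone (D := D) (w := v) hψ hmem (by
    filter_upwards [hb] with x' hx' hxD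
    refine (key (x' - p) c hc0 hx'.1 hx'.2).1 ?_
    simpa using hxD) (by rwa [hψx])
  have e : (c • ContinuousLinearMap.id ℝ X).adjoint v = c • v := by
    refine ext_inner_right ℝ fun y => ?_
    rw [ContinuousLinearMap.adjoint_inner_left]
    simp [inner_smul_left, inner_smul_right]
  rw [e] at this
  have h2 := regularNormalCone_smul this (inv_pos.2 hc0)
  rwa [smul_smul, inv_mul_cancel₀ hc0.ne', one_smul] at h2

/-- Near `z`, a continuously differentiable change of coordinates turns `C` into a cone. -/
def HasConicChartAt (C : Set X) (z : X) : Prop :=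
  ∃ (ψ φ : X → X) (D : Set X), ContDiffAt ℝ 1 ψ z ∧ ContDiffAt ℝ 1 φ (ψ z) ∧
    (∀ᶠ x in 𝓝 z, φ (ψ x) = x) ∧ (∀ᶠ y in 𝓝 (ψ z), ψ (φ y) = y) ∧
    (∀ᶠ x in 𝓝 z, (x ∈ C ↔ ψ x ∈ D)) ∧ LocallyConicAt D (ψ z)

theorem HasFDerivAt.tendsto_inv_smul_sub {E F : Type*} [NormedAddCommGroup E] [NormedSpace ℝ E]
    [NormedAddCommGroup F] [NormedSpace ℝ F] {f : E → F} {A : E →L[ℝ] F} {z d : E}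
    (hf : HasFDerivAt f A z) {t : ℕ → ℝ} {dk : ℕ → E} (ht : ∀ k, 0 < t k)
    (ht0 : Tendsto t atTop (𝓝 0)) (hd : Tendsto dk atTop (𝓝 d)) :
    Tendsto (fun k => (t k)⁻¹ • (f (z + t k • dk k) - f z)) atTop (𝓝 (A d)) := by
  have hz : Tendsto (fun k => z + t k • dk k) atTop (𝓝 z) := by
    simpa using (ht0.smul hd).const_add z
  have h1 := hf.isLittleO.comp_tendsto hz
  have h2 : (fun k => t k • dk k) =O[atTop] t := by
    simpa using (Asymptotics.isBigO_refl t atTop).smul (hd.isBigO_one ℝ)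
  have h3 : (fun k => f (z + t k • dk k) - f z - A (t k • dk k)) =o[atTop] t := by
    refine Asymptotics.IsLittleO.trans_isBigO ?_ h2
    simpa [Function.comp_def] using h1
  have h4 : Tendsto (fun k => (t k)⁻¹ • (f (z + t k • dk k) - f z - A (t k • dk k)))
      atTop (𝓝 0) := h3.tendsto_inv_smul_nhds_zero
  have h5 := h4.add ((A.continuous.tendsto d).comp hd)
  rw [zero_add] at h5
  refine h5.congr fun k => ?_
  simp only [Function.comp]
  rw [smul_sub, map_smul, smul_smul, inv_mul_cancel₀ (ht k).ne', one_smul, sub_add_cancel]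

theorem tendsto_clm_apply {ι E F : Type*} [NormedAddCommGroup E] [NormedSpace ℝ E]
    [NormedAddCommGroup F] [NormedSpace ℝ F] {l : Filter ι} {L : ι → E →L[ℝ] F} {x : ι → E}
    {L₀ : E →L[ℝ] F} {x₀ : E} (hL : Tendsto L l (𝓝 L₀)) (hx : Tendsto x l (𝓝 x₀)) :
    Tendsto (fun i => L i (x i)) l (𝓝 (L₀ x₀)) :=
  (isBoundedBilinearMap_apply.continuous.tendsto (L₀, x₀)).comp (hL.prodMk_nhds hx)

/-- In the chart, the points become `ψ z + t k • e k` with `e k → A d`. Conicity allows `t k` to be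
replaced by `s k` with the same `e k` and the same normals; the result is then carried back by the
inverse chart. Continuity of the derivatives of both charts preserves the limits. -/
theorem HasConicChartAt.directionallyUniformAt [CompleteSpace X] {C : Set X} {z : X}
    (h : HasConicChartAt C z) : DirectionallyUniformAt C z := by
  obtain ⟨ψ, φ, D, hψ, hφ, hφψ, hψφ, hCD, hD⟩ := h
  obtain ⟨ε, hε, hD⟩ := hD.exists_regularNormalCone_congr
  rintro d v ⟨t, dk, vk, ht, ht0, hdk, hvk, hN⟩ s hs hs0
  have hφz : φ (ψ z) = z := hφψ.self_of_nhds
  set A := fderiv ℝ ψ z with hA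
  set B := fderiv ℝ φ (ψ z) with hB
  have hAz : HasFDerivAt ψ A z := (hψ.differentiableAt one_ne_zero).hasFDerivAt
  have hBz : HasFDerivAt φ B (ψ z) := (hφ.differentiableAt one_ne_zero).hasFDerivAt
  have hBA : ∀ x, B (A x) = x := by
    have h1 : HasFDerivAt (φ ∘ ψ) (B.comp A) z := hBz.comp z hAz
    have h2 : HasFDerivAt (φ ∘ ψ) (ContinuousLinearMap.id ℝ X) z :=
      (hasFDerivAt_id z).congr_of_eventuallyEq hφψ
    intro x
    exact congrArg (fun L : X →L[ℝ] X => L x) (h1.unique h2)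
  have hxk : Tendsto (fun k => z + t k • dk k) atTop (𝓝 z) := by
    simpa using (ht0.smul hdk).const_add z
  have hψxk : Tendsto (fun k => ψ (z + t k • dk k)) atTop (𝓝 (ψ z)) :=
    hψ.continuousAt.tendsto.comp hxk
  let e : ℕ → X := fun k => (t k)⁻¹ • (ψ (z + t k • dk k) - ψ z)
  have he : Tendsto e atTop (𝓝 (A d)) := HasFDerivAt.tendsto_inv_smul_sub hAz ht ht0 hdk
  have hte : ∀ k, ψ z + t k • e k = ψ (z + t k • dk k) := fun k => by
    simp only [e]
    rw [smul_smul, mul_inv_cancel₀ (ht k).ne', one_smul, add_sub_cancel]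
  -- Since `φ` maps `D` into `C` locally, the adjoint of its derivative turns normals to `C` into
  -- normals to `D`.
  let w : ℕ → X := fun k => (fderiv ℝ φ (ψ (z + t k • dk k))).adjoint (vk k)
  have hcφ : ContinuousAt (fderiv ℝ φ) (ψ z) := hφ.continuousAt_fderiv one_ne_zero
  have hcψ : ContinuousAt (fderiv ℝ ψ) z := hψ.continuousAt_fderiv one_ne_zero
  have adj : Continuous (fun L : X →L[ℝ] X => L.adjoint) :=
    ContinuousLinearMap.adjoint.continuous
  have hw : Tendsto w atTop (𝓝 (B.adjoint v)) :=
    tendsto_clm_apply ((adj.tendsto B).comp (hcφ.tendsto.comp hψxk)) hvk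
  have hyk : Tendsto (fun k => ψ z + s k • e k) atTop (𝓝 (ψ z)) := by
    simpa using (hs0.smul he).const_add (ψ z)
  have hφyk : Tendsto (fun k => φ (ψ z + s k • e k)) atTop (𝓝 z) := by
    have := hφ.continuousAt.tendsto.comp hyk
    rwa [hφz] at this
  let d' : ℕ → X := fun k => (s k)⁻¹ • (φ (ψ z + s k • e k) - φ (ψ z))
  have hsd : ∀ k, z + s k • d' k = φ (ψ z + s k • e k) := fun k => by
    simp only [d']
    rw [smul_smul, mul_inv_cancel₀ (hs k).ne', one_smul, hφz, add_sub_cancel]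
  refine ⟨d', fun k => (fderiv ℝ ψ (φ (ψ z + s k • e k))).adjoint (w k), ?_, ?_, ?_⟩
  · rw [← hBA d]
    exact HasFDerivAt.tendsto_inv_smul_sub hBz hs hs0 he
  · have e1 : A.adjoint (B.adjoint v) = v := by
      refine ext_inner_right ℝ fun y => ?_
      rw [ContinuousLinearMap.adjoint_inner_left, ContinuousLinearMap.adjoint_inner_left, hBA]
    have := tendsto_clm_apply ((adj.tendsto A).comp (hcψ.tendsto.comp hφyk)) hw
    rwa [e1] at this
  have n1 : ∀ᶠ k in atTop, ‖t k • e k‖ < ε := by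
    have : Tendsto (fun k => ‖t k • e k‖) atTop (𝓝 0) := by
      simpa using (ht0.smul he).norm
    exact this.eventually_lt_const hε
  have n2 : ∀ᶠ k in atTop, ‖s k • e k‖ < ε := by
    have : Tendsto (fun k => ‖s k • e k‖) atTop (𝓝 0) := by
      simpa using (hs0.smul he).norm
    exact this.eventually_lt_const hε
  have dφ : ∀ᶠ y in 𝓝 (ψ z), DifferentiableAt ℝ φ y :=
    (hφ.eventually (by simp)).mono fun y hy => hy.differentiableAt one_ne_zero
  have dψ : ∀ᶠ x in 𝓝 z, DifferentiableAt ℝ ψ x :=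
    (hψ.eventually (by simp)).mono fun y hy => hy.differentiableAt one_ne_zero
  have mφ : ∀ᶠ y in 𝓝 (ψ z), (y ∈ D ↔ φ y ∈ C) := by
    have h1 : ∀ᶠ y in 𝓝 (ψ z), (φ y ∈ C ↔ ψ (φ y) ∈ D) := by
      have : Tendsto φ (𝓝 (ψ z)) (𝓝 z) := by simpa [hφz] using hφ.continuousAt.tendsto
      exact this.eventually hCD
    filter_upwards [h1, hψφ] with y h1 h2
    rw [h1, h2]
  filter_upwards [n1, n2, hψxk.eventually dφ, hφyk.eventually dψ, hψxk.eventually mφ,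
    hψxk.eventually mφ.eventually_nhds, hyk.eventually mφ, hyk.eventually hψφ, hxk.eventually hφψ,
    hφyk.eventually hCD.eventually_nhds, hxk.eventually hCD]
    with k n1 n2 d1 d2 m1 m2 m3 i1 i2 c1 c2
  have hwk : w k ∈ regularNormalCone D (ψ (z + t k • dk k)) := by
    refine adjoint_mem_regularNormalCone d1.hasFDerivAt (c2.1 (hN k).1)
      (m2.mono fun y hy => hy.1) ?_
    rw [i2]
    exact hN k
  rw [← hte] at hwk
  have hwk' := hD (e k) (t k) (s k) (ht k) (hs k) n1 n2 _ hwk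
  rw [hsd]
  refine adjoint_mem_regularNormalCone d2.hasFDerivAt (m3.1 hwk'.1) (c1.mono fun x hx => hx.1) ?_
  rwa [i1]

end NormalCones

/-! ### Penalization, approximate multipliers and the abstract error bound -/

section ErrorBound

theorem norm_fderiv_le_of_eventually_le_add {E : Type*} [NormedAddCommGroup E] [NormedSpace ℝ E]
    {θ : E → ℝ} {A : E →L[ℝ] ℝ} {z : E} {c : ℝ} (hc : 0 ≤ c) (hθ : HasFDerivAt θ A z)
    (hmin : ∀ᶠ z' in 𝓝 z, θ z ≤ θ z' + c * ‖z' - z‖) : ‖A‖ ≤ c := by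
  have key : ∀ v, -(c * ‖v‖) ≤ A v := by
    intro v
    have ht : ∀ k : ℕ, (0 : ℝ) < 1 / ((k : ℝ) + 1) := fun k => Nat.one_div_pos_of_nat
    have ht0 := tendsto_one_div_add_atTop_nhds_zero_nat (𝕜 := ℝ)
    have h1 := HasFDerivAt.tendsto_inv_smul_sub hθ ht ht0 (tendsto_const_nhds (x := v))
    have h2 : Tendsto (fun k : ℕ => z + (1 / ((k : ℝ) + 1)) • v) atTop (𝓝 z) := by
      simpa using (ht0.smul_const v).const_add z
    refine ge_of_tendsto h1 ?_
    filter_upwards [h2.eventually hmin] with k hk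
    rw [add_sub_cancel_left, norm_smul, Real.norm_of_nonneg (ht k).le] at hk
    rw [smul_eq_mul, ← mul_le_mul_iff_right₀ (ht k), mul_inv_cancel_left₀ (ht k).ne']
    linarith
  refine A.opNorm_le_bound hc fun v => ?_
  rw [Real.norm_eq_abs, abs_le]
  refine ⟨key v, ?_⟩
  have := key (-v)
  rw [norm_neg, map_neg] at this
  linarith

variable {E Y Z : Type*} [NormedAddCommGroup E] [InnerProductSpace ℝ E]
  [NormedAddCommGroup Y] [InnerProductSpace ℝ Y] [NormedAddCommGroup Z] [InnerProductSpace ℝ Z]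

/-- Fermat's rule over a set. -/
theorem mem_regularNormalCone_of_eventually_le {D : Set Y} {θ : Y → ℝ} {μ q : Y} (hq : q ∈ D)
    (hθ : HasFDerivAt θ (-(innerSL ℝ μ)) q) (hmin : ∀ᶠ q' in 𝓝[D] q, θ q ≤ θ q') :
    μ ∈ regularNormalCone D q := by
  refine ⟨hq, fun ε hε => ?_⟩
  filter_upwards [hmin, nhdsWithin_le_nhds (hθ.isLittleO.def hε)] with q' h1 h2
  have := (abs_le.1 (Real.norm_eq_abs _ ▸ h2)).2
  simp only [neg_apply, innerSL_apply_apply] at this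
  linarith

/-- Expanding ‖y - p'‖² ≥ ‖y - p‖² gives 2⟪y - p, p' - p⟫ ≤ ‖p' - p‖², a second-order bound. -/
theorem sub_mem_regularNormalCone_of_infDist_eq {D : Set Y} {y p : Y} (hp : p ∈ D)
    (h : Metric.infDist y D = dist y p) : y - p ∈ regularNormalCone D p := by
  refine ⟨hp, fun ε hε => ?_⟩
  filter_upwards [self_mem_nhdsWithin, nhdsWithin_le_nhds (Metric.ball_mem_nhds p hε)]
    with p' hp' hb
  have h1 : ‖y - p‖ ≤ ‖y - p'‖ := by
    rw [← dist_eq_norm, ← dist_eq_norm, ← h]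
    exact Metric.infDist_le_dist_of_mem hp'
  have h2 : ‖y - p'‖ ^ 2 = ‖y - p‖ ^ 2 - 2 * inner ℝ (y - p) (p' - p) + ‖p' - p‖ ^ 2 := by
    rw [← norm_sub_sq_real]
    congr 2
    abel
  have h3 : ‖p' - p‖ < ε := by simpa [dist_eq_norm] using hb
  have h4 : ‖y - p‖ ^ 2 ≤ ‖y - p'‖ ^ 2 := by gcongr
  nlinarith [norm_nonneg (p' - p)]

/-- Approximate multiplier rule: an approximate local minimizer of `φ + K d_Λ ∘ F` on `F⁻¹(Λ)`
has a bounded approximate multiplier which is a regular normal to `Λ` at a nearby point. -/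
theorem exists_regularNormal_of_penalized_min [ProperSpace E] [ProperSpace Y]
    {F : E → Y} {Lam : Set Y} {φ : E → ℝ} {u : E} {K ε δ : ℝ} (hLam : IsClosed Lam)
    (hF : ContDiff ℝ 1 F) (hφ : ContDiffAt ℝ 1 φ u) (hu : F u ∈ Lam) (hK : 0 < K) (hε : 0 < ε)
    (hδ : 0 < δ)
    (hmin : ∀ᶠ z in 𝓝 u, φ u ≤ φ z + K * Metric.infDist (F z) Lam + ε * ‖z - u‖) :
    ∃ q μ : Y, μ ∈ regularNormalCone Lam q ∧ ‖q - F u‖ ≤ δ ∧ ‖μ‖ ≤ K ∧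
      ‖fderiv ℝ φ u + (innerSL ℝ μ).comp (fderiv ℝ F u)‖ ≤ 3 * ε := by
  have hFc : Continuous F := hF.continuous
  have e1 : ∀ᶠ z in 𝓝 u, ‖F z - F u‖ < δ / 4 := by
    have : Tendsto (fun z => ‖F z - F u‖) (𝓝 u) (𝓝 0) := by
      have : ContinuousAt (fun z => ‖F z - F u‖) u := by fun_prop
      simpa using this.tendsto
    exact this.eventually_lt_const (by positivity)
  have e2 : ∀ᶠ z in 𝓝 u, |φ z - φ u| < K * δ / 4 := by
    have hc := hφ.continuousAt
    have : Tendsto (fun z => |φ z - φ u|) (𝓝 u) (𝓝 0) := by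
      have : ContinuousAt (fun z => |φ z - φ u|) u := by fun_prop
      simpa using this.tendsto
    exact this.eventually_lt_const (by positivity)
  have e3 : ∀ᶠ z in 𝓝 u, ‖fderiv ℝ φ z - fderiv ℝ φ u‖ < ε / 2 := by
    have hc := hφ.continuousAt_fderiv one_ne_zero
    have : Tendsto (fun z => ‖fderiv ℝ φ z - fderiv ℝ φ u‖) (𝓝 u) (𝓝 0) := by
      have : ContinuousAt (fun z => ‖fderiv ℝ φ z - fderiv ℝ φ u‖) u := by fun_prop
      simpa using this.tendsto
    exact this.eventually_lt_const (by positivity)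
  have e4 : ∀ᶠ z in 𝓝 u, ‖fderiv ℝ F z - fderiv ℝ F u‖ < ε / (2 * K) := by
    have hc := hF.continuous_fderiv one_ne_zero
    have : Tendsto (fun z => ‖fderiv ℝ F z - fderiv ℝ F u‖) (𝓝 u) (𝓝 0) := by
      have : ContinuousAt (fun z => ‖fderiv ℝ F z - fderiv ℝ F u‖) u := by fun_prop
      simpa using this.tendsto
    exact this.eventually_lt_const (by positivity)
  have e5 : ∀ᶠ z in 𝓝 u, ContDiffAt ℝ 1 φ z := hφ.eventually (by simp)
  obtain ⟨ρ, hρ, hball⟩ := Metric.nhds_basis_closedBall.eventually_iff.1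
    (hmin.and (e1.and (e2.and (e3.and (e4.and e5)))))
  -- The first bound will keep the minimizing `q` inside the ball of radius `2 * δ`, the second will
  -- keep `z` inside the ball of radius `ρ`, so that both first-order conditions hold at interior
  -- points of the balls.
  obtain ⟨η, hη, hηδ, hηρ⟩ : ∃ η > 0, η ≤ δ / 4 ∧ K * η < ε * ρ := by
    refine ⟨min (δ / 4) (ε * ρ / (2 * K)), by positivity, min_le_left _ _, ?_⟩
    calc K * min (δ / 4) (ε * ρ / (2 * K)) ≤ K * (ε * ρ / (2 * K)) := by
          gcongr; exact min_le_right _ _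
      _ = ε * ρ / 2 := by field_simp
      _ < ε * ρ := half_lt_self (by positivity)
  -- The distance to `Lam` is replaced by a smoothed distance to a free point `q` of `Lam`; `η`
  -- makes it differentiable even where `F z = q`.
  let N : E → Y → ℝ := fun z q => √(‖F z - q‖ ^ 2 + η ^ 2)
  have hNpos : ∀ z q, 0 < ‖F z - q‖ ^ 2 + η ^ 2 := fun z q => by positivity
  have hN : ∀ z q, ‖F z - q‖ ≤ N z q := fun z q =>
    Real.le_sqrt_of_sq_le (by nlinarith [sq_nonneg η])
  -- Of the weight `2 * ε`, one `ε` is absorbed by `hmin`; the other yields `ε * ‖z - u‖ ≤ K * η`.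
  let h : E × Y → ℝ := fun x => φ x.1 + 2 * ε * ‖x.1 - u‖ + K * N x.1 x.2
  have hcomp : IsCompact (Metric.closedBall u ρ ×ˢ (Lam ∩ Metric.closedBall (F u) (2 * δ))) :=
    (isCompact_closedBall _ _).prod ((isCompact_closedBall _ _).inter_left hLam)
  have hcont : ContinuousOn h
      (Metric.closedBall u ρ ×ˢ (Lam ∩ Metric.closedBall (F u) (2 * δ))) := by
    have hφc : ContinuousOn φ (Metric.closedBall u ρ) := fun z hz =>
      (hball hz).2.2.2.2.2.continuousAt.continuousWithinAt
    have : ContinuousOn (fun x : E × Y => φ x.1)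
        (Metric.closedBall u ρ ×ˢ (Lam ∩ Metric.closedBall (F u) (2 * δ))) :=
      hφc.comp continuousOn_fst fun x hx => hx.1
    have h2 : Continuous (fun x : E × Y => 2 * ε * ‖x.1 - u‖ + K * N x.1 x.2) := by
      simp only [N]
      fun_prop
    exact (this.add h2.continuousOn).congr fun x _ => add_assoc _ _ _
  obtain ⟨⟨z, q⟩, ⟨hz, hqL, hqb⟩, hzq⟩ := hcomp.exists_isMinOn
    ⟨(u, F u), Metric.mem_closedBall_self hρ.le, hu,
      Metric.mem_closedBall_self (by positivity)⟩ hcont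
  obtain ⟨b0, b1, b2, b3, b4, b5⟩ := hball hz
  have hval : φ z + 2 * ε * ‖z - u‖ + K * N z q ≤ φ u + K * η := by
    have := isMinOn_iff.1 hzq (u, F u) ⟨Metric.mem_closedBall_self hρ.le, hu,
      Metric.mem_closedBall_self (by positivity)⟩
    simpa [h, N, Real.sqrt_sq hη.le] using this
  have hzu : ε * ‖z - u‖ ≤ K * η := by
    have h1 : Metric.infDist (F z) Lam ≤ ‖F z - q‖ := by
      rw [← dist_eq_norm]
      exact Metric.infDist_le_dist_of_mem hqL
    have h2 : K * Metric.infDist (F z) Lam ≤ K * N z q := by gcongr; exact h1.trans (hN z q)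
    linarith
  have hzρ : ‖z - u‖ < ρ := by
    by_contra hcon
    rw [not_lt] at hcon
    have : ε * ρ ≤ ε * ‖z - u‖ := by gcongr
    linarith
  have hFq : ‖F z - q‖ ≤ δ / 2 := by
    have h1 := (abs_lt.1 b2).1
    have h2 : 0 ≤ 2 * ε * ‖z - u‖ := by positivity
    have h3 : K * N z q ≤ K * (δ / 2) := by
      have : K * η ≤ K * (δ / 4) := by gcongr
      linarith
    exact (hN z q).trans (le_of_mul_le_mul_left h3 hK)
  have hqu : ‖q - F u‖ ≤ 3 / 4 * δ := by
    have : q - F u = (F z - F u) - (F z - q) := by abel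
    rw [this]
    refine (norm_sub_le _ _).trans ?_
    linarith
  have hS : 0 < N z q := Real.sqrt_pos.2 (hNpos z q)
  -- Minus the gradient of `K * N z ·` at `q`, so that Fermat's rule over `Lam` makes it normal.
  let μ : Y := (K / N z q) • (F z - q)
  have hq' : μ ∈ regularNormalCone Lam q := by
    refine mem_regularNormalCone_of_eventually_le (θ := fun q' => K * N z q') hqL ?_ ?_
    · have h1 : HasFDerivAt (fun q' : Y => ‖F z - q'‖ ^ 2 + η ^ 2)
          (2 • (innerSL ℝ (F z - q)).comp (-(ContinuousLinearMap.id ℝ Y))) q :=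
        (((hasFDerivAt_id q).const_sub (F z)).norm_sq).add_const _
      have h2 := (h1.sqrt (hNpos z q).ne').const_mul K
      refine h2.congr_fderiv ?_
      ext y
      simp [μ, N, innerSL_apply_apply]
      ring
    · have : ∀ᶠ q' in 𝓝 q, q' ∈ Metric.closedBall (F u) (2 * δ) := by
        have : q ∈ Metric.ball (F u) (2 * δ) := by
          rw [Metric.mem_ball, dist_eq_norm]; linarith
        filter_upwards [Metric.isOpen_ball.mem_nhds this] with q' hq'
        exact Metric.ball_subset_closedBall hq'
      filter_upwards [nhdsWithin_le_nhds this, self_mem_nhdsWithin] with q' h1 h2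
      have := isMinOn_iff.1 hzq (z, q') ⟨hz, h2, h1⟩
      simpa [h] using this
  have hμK : ‖μ‖ ≤ K := by
    rw [norm_smul, Real.norm_of_nonneg (by positivity), div_mul_eq_mul_div, div_le_iff₀ hS]
    gcongr
    exact hN z q
  have hder : ‖fderiv ℝ φ z + (innerSL ℝ μ).comp (fderiv ℝ F z)‖ ≤ 2 * ε := by
    refine norm_fderiv_le_of_eventually_le_add (θ := fun z' => φ z' + K * N z' q) (z := z)
      (by positivity) ?_ ?_
    · have h0 : HasFDerivAt F (fderiv ℝ F z) z :=
        (hF.differentiable one_ne_zero z).hasFDerivAt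
      have h1 : HasFDerivAt (fun z' : E => ‖F z' - q‖ ^ 2 + η ^ 2)
          (2 • (innerSL ℝ (F z - q)).comp (fderiv ℝ F z)) z :=
        ((h0.sub_const q).norm_sq).add_const _
      have h2 := (b5.differentiableAt one_ne_zero).hasFDerivAt.add
        ((h1.sqrt (hNpos z q).ne').const_mul K)
      refine h2.congr_fderiv ?_
      ext y
      simp [μ, N, innerSL_apply_apply]
      ring
    · have : ∀ᶠ z' in 𝓝 z, z' ∈ Metric.closedBall u ρ := by
        have : z ∈ Metric.ball u ρ := by
          rw [Metric.mem_ball, dist_eq_norm]; exact hzρ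
        filter_upwards [Metric.isOpen_ball.mem_nhds this] with q' hq'
        exact Metric.ball_subset_closedBall hq'
      filter_upwards [this] with z' h1
      have h2 := isMinOn_iff.1 hzq (z', q) ⟨h1, hqL, hqb⟩
      simp only [h] at h2
      have h3 : ‖z' - u‖ ≤ ‖z' - z‖ + ‖z - u‖ := norm_sub_le_norm_sub_add_norm_sub _ _ _
      nlinarith
  refine ⟨q, μ, hq', by linarith, hμK, ?_⟩
  have h1 : fderiv ℝ φ u + (innerSL ℝ μ).comp (fderiv ℝ F u) =
      (fderiv ℝ φ z + (innerSL ℝ μ).comp (fderiv ℝ F z)) - (fderiv ℝ φ z - fderiv ℝ φ u) -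
        (innerSL ℝ μ).comp (fderiv ℝ F z - fderiv ℝ F u) := by
    rw [ContinuousLinearMap.comp_sub]
    abel
  have h2 : ‖(innerSL ℝ μ).comp (fderiv ℝ F z - fderiv ℝ F u)‖ ≤ ε / 2 := by
    refine (ContinuousLinearMap.opNorm_comp_le _ _).trans ?_
    rw [innerSL_apply_norm]
    calc ‖μ‖ * ‖fderiv ℝ F z - fderiv ℝ F u‖ ≤ K * (ε / (2 * K)) := by gcongr
      _ = ε / 2 := by field_simp
  rw [h1]
  refine (norm_sub_le _ _).trans ?_
  have := norm_sub_le (fderiv ℝ φ z + (innerSL ℝ μ).comp (fderiv ℝ F z))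
    (fderiv ℝ φ z - fderiv ℝ φ u)
  linarith

/-- If the error bound fails then there are penalized minimizers, feasible for `F` and infeasible
for `P`, arbitrarily close to the reference point. -/
theorem exists_penalized_min_of_not_errorBound [ProperSpace E] {F : E → Y} {P : E → Z}
    {Lam : Set Y} {Om : Set Z} {zs : E} (hLam : IsClosed Lam) (hF : ContDiff ℝ 1 F) (hP : ContDiff ℝ 1 P)
    (hPz : P zs ∈ Om) (hsub : MetricallySubregularAt F Lam zs)
    (hnot : ¬ ∃ κ > 0, ∀ᶠ z in 𝓝 zs, Metric.infDist z {u | F u ∈ Lam ∧ P u ∈ Om} ≤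
      κ * (Metric.infDist (F z) Lam + Metric.infDist (P z) Om)) :
    ∃ K > 0, ∀ ε, 0 < ε → ε ≤ 1 → ∃ u, u ≠ zs ∧ ‖u - zs‖ < ε ∧ F u ∈ Lam ∧ P u ∉ Om ∧
      Metric.infDist (P u) Om ≤ ε * ‖u - zs‖ ∧ ∀ᶠ z in 𝓝 u, Metric.infDist (P u) Om ≤
        Metric.infDist (P z) Om + K * Metric.infDist (F z) Lam + ε * ‖z - u‖ := by
  obtain ⟨hFz, κ, hκ, hsub⟩ := hsub
  obtain ⟨L, t, ht, hL⟩ := (hP.contDiffAt (x := zs)).exists_lipschitzOnWith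
  obtain ⟨R, hR, hball⟩ := Metric.nhds_basis_closedBall.eventually_iff.1
    (hsub.and (show ∀ᶠ z in 𝓝 zs, z ∈ t from ht))
  -- Moving `u` to its projection on `F⁻¹(Lam)` raises the other terms of `g` at rate at most `L +
  -- 1`: `L` from `P` and `ε ≤ 1` from the norm term. The penalty rate must exceed this after
  -- division by `κ`.
  set K : ℝ := (L + 2) * κ with hKdef
  have hK : 0 < K := by positivity
  set Sol : Set E := {u | F u ∈ Lam ∧ P u ∈ Om} with hSol
  have hzsSol : zs ∈ Sol := ⟨hFz, hPz⟩
  have hSclosed : IsClosed {u | F u ∈ Lam} := hLam.preimage hF.continuous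
  refine ⟨K, hK, fun ε hε hε1 => ?_⟩
  -- With `‖u - zs‖ ≤ 3 / 2 * ‖z - zs‖` below, `ε / 2` gives `‖u - zs‖ < ε`, and `R / 4` keeps both
  -- `u` and its projection in the ball of radius `R`.
  set ρ := min (ε / 2) (R / 4) with hρdef
  have hρ : 0 < ρ := by positivity
  have hρε : ρ ≤ ε / 2 := min_le_left _ _
  have hρR : ρ ≤ R / 4 := min_le_right _ _
  -- This constant makes `g z ≤ ε ^ 2 / 2 * Metric.infDist z Sol`. One factor `ε` is spent on `‖u -
  -- z‖ ≤ 1 / 2 * Metric.infDist z Sol`, which keeps `u` out of `Sol`; the square also gives the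
  -- smallness of the residual of `P` at `u`.
  obtain ⟨z, hzρ, hz⟩ : ∃ z, ‖z - zs‖ < ρ ∧ 2 * (1 + K) / ε ^ 2 *
      (Metric.infDist (F z) Lam + Metric.infDist (P z) Om) < Metric.infDist z Sol := by
    by_contra hcon
    push Not at hcon
    refine hnot ⟨2 * (1 + K) / ε ^ 2, by positivity, ?_⟩
    filter_upwards [Metric.ball_mem_nhds zs hρ] with z hz
    exact hcon z (by simpa [dist_eq_norm] using hz)
  have nF : ∀ z, 0 ≤ Metric.infDist (F z) Lam := fun z => Metric.infDist_nonneg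
  have nP : ∀ z, 0 ≤ Metric.infDist (P z) Om := fun z => Metric.infDist_nonneg
  let g : E → ℝ := fun x =>
    Metric.infDist (P x) Om + K * Metric.infDist (F x) Lam + ε * ‖x - z‖
  have hgc : Continuous g := by
    have h1 : Continuous fun x => Metric.infDist (P x) Om :=
      (Metric.continuous_infDist_pt Om).comp hP.continuous
    have h2 : Continuous fun x => Metric.infDist (F x) Lam :=
      (Metric.continuous_infDist_pt Lam).comp hF.continuous
    fun_prop
  have hzR : z ∈ Metric.closedBall zs R := by
    rw [Metric.mem_closedBall, dist_eq_norm]; linarith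
  obtain ⟨u, huR, hu⟩ := (isCompact_closedBall zs R).exists_isMinOn ⟨z, hzR⟩ hgc.continuousOn
  rw [isMinOn_iff] at hu
  have hgz : g z ≤ ε ^ 2 / 2 * Metric.infDist z Sol := by
    have h1 : g z ≤ (1 + K) * (Metric.infDist (F z) Lam + Metric.infDist (P z) Om) := by
      simp only [g, sub_self, norm_zero, mul_zero, add_zero]
      nlinarith [nF z, nP z]
    refine h1.trans ?_
    have h2 := mul_le_mul_of_nonneg_left hz.le (show 0 ≤ ε ^ 2 / 2 by positivity)
    refine le_trans (le_of_eq ?_) h2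
    field_simp
  have hgu : g u ≤ ε ^ 2 / 2 * Metric.infDist z Sol := (hu z hzR).trans hgz
  have hdz : Metric.infDist z Sol ≤ ‖z - zs‖ := by
    rw [← dist_eq_norm]; exact Metric.infDist_le_dist_of_mem hzsSol
  have hd0 : 0 < Metric.infDist z Sol := by
    refine lt_of_le_of_lt ?_ hz
    have := nF z
    have := nP z
    positivity
  have huz : ‖u - z‖ ≤ 1 / 2 * Metric.infDist z Sol := by
    have h1 : ε * ‖u - z‖ ≤ g u := by
      simp only [g]
      nlinarith [nF u, nP u]
    have h2 : ε * ‖u - z‖ ≤ ε * (ε / 2 * Metric.infDist z Sol) := by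
      refine h1.trans (hgu.trans (le_of_eq ?_))
      ring
    have h3 := le_of_mul_le_mul_left h2 hε
    nlinarith
  have huzs : ‖u - zs‖ ≤ 3 / 2 * ‖z - zs‖ := by
    have : ‖u - zs‖ ≤ ‖u - z‖ + ‖z - zs‖ := norm_sub_le_norm_sub_add_norm_sub _ _ _
    linarith
  have huR2 : ‖u - zs‖ ≤ R / 2 := by linarith
  obtain ⟨hsubu, hut⟩ := hball huR
  have hFu : F u ∈ Lam := by
    obtain ⟨u', hu', hd⟩ := hSclosed.exists_infDist_eq_dist ⟨zs, hFz⟩ u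
    rw [hd, dist_eq_norm] at hsubu
    have h1 : ‖u - u'‖ ≤ ‖u - zs‖ := by
      rw [← dist_eq_norm, ← dist_eq_norm, ← hd]
      exact Metric.infDist_le_dist_of_mem hFz
    have hu'R : u' ∈ Metric.closedBall zs R := by
      rw [Metric.mem_closedBall, dist_eq_norm]
      have : ‖u' - zs‖ ≤ ‖u' - u‖ + ‖u - zs‖ := norm_sub_le_norm_sub_add_norm_sub _ _ _
      rw [norm_sub_rev u' u] at this
      linarith
    have h2 : Metric.infDist (P u') Om ≤ Metric.infDist (P u) Om + L * ‖u - u'‖ := by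
      have h3 := Metric.infDist_le_infDist_add_dist (s := Om) (x := P u') (y := P u)
      have h4 := hL.dist_le_mul u' (hball hu'R).2 u hut
      rw [dist_comm u' u, dist_eq_norm u u'] at h4
      linarith
    have h3 : Metric.infDist (F u') Lam = 0 := Metric.infDist_zero_of_mem hu'
    have h4 : ‖u' - z‖ ≤ ‖u - u'‖ + ‖u - z‖ := by
      have : ‖u' - z‖ ≤ ‖u' - u‖ + ‖u - z‖ := norm_sub_le_norm_sub_add_norm_sub _ _ _
      rwa [norm_sub_rev u' u] at this
    have h5 := hu u' hu'R
    simp only [g, h3, mul_zero, add_zero] at h5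
    have h6 : ε * ‖u' - z‖ ≤ ‖u - u'‖ + ε * ‖u - z‖ := by
      nlinarith [norm_nonneg (u - u')]
    have h7 : K * Metric.infDist (F u) Lam ≤ (L + 1) * ‖u - u'‖ := by linarith
    have h8 : (L + 1) * ‖u - u'‖ ≤ (L + 1) * (κ * Metric.infDist (F u) Lam) := by
      gcongr
    have h9 : κ * Metric.infDist (F u) Lam ≤ 0 := by
      rw [hKdef] at h7
      linarith
    have h10 : Metric.infDist (F u) Lam = 0 :=
      le_antisymm (nonpos_of_mul_nonpos_right h9 hκ) (nF u)
    exact (hLam.mem_iff_infDist_zero ⟨F zs, hFz⟩).2 h10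
  have hdu : Metric.infDist z Sol ≤ Metric.infDist u Sol + ‖u - z‖ := by
    rw [← dist_eq_norm, dist_comm]
    exact Metric.infDist_le_infDist_add_dist
  have hdu0 : 0 < Metric.infDist u Sol := by linarith
  have hdus : Metric.infDist u Sol ≤ ‖u - zs‖ := by
    rw [← dist_eq_norm]; exact Metric.infDist_le_dist_of_mem hzsSol
  refine ⟨u, ?_, by linarith, hFu, ?_, ?_, ?_⟩
  · rintro rfl
    simp at hdus
    linarith
  · intro hPu
    rw [Metric.infDist_zero_of_mem (show u ∈ Sol from ⟨hFu, hPu⟩)] at hdu0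
    exact lt_irrefl _ hdu0
  · have h1 : Metric.infDist (P u) Om ≤ g u := by
      simp only [g]
      have := nF u
      have : 0 ≤ K * Metric.infDist (F u) Lam + ε * ‖u - z‖ := by positivity
      linarith
    have h2 : Metric.infDist z Sol ≤ 2 * ‖u - zs‖ := by linarith
    calc _ ≤ ε ^ 2 / 2 * (2 * ‖u - zs‖) := h1.trans (hgu.trans (by gcongr))
      _ = ε * (ε * ‖u - zs‖) := by ring
      _ ≤ 1 * (ε * ‖u - zs‖) := by gcongr
      _ = _ := one_mul _
  · have : ∀ᶠ x in 𝓝 u, x ∈ Metric.closedBall zs R := by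
      have : u ∈ Metric.ball zs R := by
        rw [Metric.mem_ball, dist_eq_norm]; linarith
      filter_upwards [Metric.isOpen_ball.mem_nhds this] with x hx
      exact Metric.ball_subset_closedBall hx
    filter_upwards [this] with x hx
    have h1 := hu x hx
    simp only [g] at h1
    have h2 : ‖x - z‖ ≤ ‖x - u‖ + ‖u - z‖ := norm_sub_le_norm_sub_add_norm_sub _ _ _
    have h3 : 0 ≤ K * Metric.infDist (F u) Lam := by
      have := nF u
      positivity
    nlinarith

/-- With `p` a projection of `P u` on `Om`, the function ‖P z - p‖ majorizes the distance to `Om`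
with equality at `u`, so `u` stays a penalized minimizer. It is C¹ near `u` because `P u ≠ p`, and
the gradient of the norm there is a unit normal to `Om` at `p`. -/
theorem exists_approximate_multipliers_of_not_errorBound [ProperSpace E] [ProperSpace Y]
    [ProperSpace Z] {F : E → Y} {P : E → Z} {Lam : Set Y}
    {Om : Set Z} {zs : E} (hLam : IsClosed Lam) (hOm : IsClosed Om) (hF : ContDiff ℝ 1 F)
    (hP : ContDiff ℝ 1 P) (hPz : P zs ∈ Om) (hsub : MetricallySubregularAt F Lam zs)
    (hnot : ¬ ∃ κ > 0, ∀ᶠ z in 𝓝 zs, Metric.infDist z {u | F u ∈ Lam ∧ P u ∈ Om} ≤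
      κ * (Metric.infDist (F z) Lam + Metric.infDist (P z) Om)) :
    ∃ K > 0, ∀ ε, 0 < ε → ε ≤ 1 → ∃ (u : E) (p : Z) (q : Y) (lam : Z) (μ : Y), u ≠ zs ∧
      ‖u - zs‖ < ε ∧ lam ∈ regularNormalCone Om p ∧ μ ∈ regularNormalCone Lam q ∧ ‖lam‖ = 1 ∧
      ‖μ‖ ≤ K ∧ ‖p - P u‖ ≤ ε * ‖u - zs‖ ∧ ‖q - F u‖ ≤ ε * ‖u - zs‖ ∧
      ‖(fderiv ℝ P u).adjoint lam + (fderiv ℝ F u).adjoint μ‖ ≤ 3 * ε := by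
  obtain ⟨K, hK, h⟩ := exists_penalized_min_of_not_errorBound hLam hF hP hPz hsub hnot
  refine ⟨K, hK, fun ε hε hε1 => ?_⟩
  obtain ⟨u, hne, huε, hFu, hPu, hd, hmin⟩ := h ε hε hε1
  obtain ⟨p, hp, hpd⟩ := hOm.exists_infDist_eq_dist ⟨P zs, hPz⟩ (P u)
  have hPp : P u - p ≠ 0 := fun h0 => hPu (by rwa [sub_eq_zero.1 h0])
  have hPp' : 0 < ‖P u - p‖ := norm_pos_iff.2 hPp
  have hPd : DifferentiableAt ℝ P u := hP.differentiable one_ne_zero u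
  have hφ : ContDiffAt ℝ 1 (fun z => ‖P z - p‖) u :=
    ((hP.contDiffAt).sub contDiffAt_const).norm ℝ hPp
  obtain ⟨q, μ, hμ, hq, hμK, hder⟩ := exists_regularNormal_of_penalized_min (δ := ε * ‖u - zs‖)
    hLam hF hφ hFu hK hε (mul_pos hε (norm_pos_iff.2 (sub_ne_zero.2 hne))) (by
      filter_upwards [hmin] with z hz
      rw [hpd, dist_eq_norm] at hz
      refine hz.trans ?_
      gcongr
      rw [← dist_eq_norm]
      exact Metric.infDist_le_dist_of_mem hp)
  refine ⟨u, p, q, ‖P u - p‖⁻¹ • (P u - p), μ, hne, huε,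
    regularNormalCone_smul (sub_mem_regularNormalCone_of_infDist_eq hp hpd) (inv_pos.2 hPp'), hμ,
    ?_, hμK, ?_, hq, ?_⟩
  · rw [norm_smul, norm_inv, norm_norm, inv_mul_cancel₀ hPp'.ne']
  · rwa [norm_sub_rev, ← dist_eq_norm, ← hpd]
  · have h1 : fderiv ℝ (fun z => ‖P z - p‖) u =
        (innerSL ℝ (‖P u - p‖⁻¹ • (P u - p))).comp (fderiv ℝ P u) := by
      have h2 : HasFDerivAt (fun z => ‖P z - p‖ ^ 2)
          (2 • (innerSL ℝ (P u - p)).comp (fderiv ℝ P u)) u :=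
        (hPd.hasFDerivAt.sub_const p).norm_sq
      have h3 := h2.sqrt (by positivity)
      simp only [Real.sqrt_sq (norm_nonneg _)] at h3
      rw [h3.fderiv]
      ext y
      simp [innerSL_apply_apply]
      ring
    have h4 : innerSL ℝ ((fderiv ℝ P u).adjoint (‖P u - p‖⁻¹ • (P u - p)) +
        (fderiv ℝ F u).adjoint μ) = fderiv ℝ (fun z => ‖P z - p‖) u +
          (innerSL ℝ μ).comp (fderiv ℝ F u) := by
      rw [h1]
      ext y
      simp only [innerSL_apply_apply, inner_add_left, ContinuousLinearMap.adjoint_inner_left,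
        add_apply, ContinuousLinearMap.comp_apply]
    rw [← innerSL_apply_norm (𝕜 := ℝ), h4]
    exact hder

/-- Limits of regular normals at points that approach `f z` like the image of a sequence with
limiting direction `w`. -/
theorem mem_directionalNormalCone_of_tendsto {f : E → Z} {A : E →L[ℝ] Z} {C : Set Z} {z w₀ : E}
    {t c : ℕ → ℝ} {w : ℕ → E} {y v : ℕ → Z} {v₀ : Z} (hf : HasFDerivAt f A z)
    (ht : ∀ k, 0 < t k) (ht0 : Tendsto t atTop (𝓝 0)) (hw : Tendsto w atTop (𝓝 w₀))
    (hc : Tendsto c atTop (𝓝 0)) (hy : ∀ k, ‖y k - f (z + t k • w k)‖ ≤ c k * t k)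
    (hv : ∀ k, v k ∈ regularNormalCone C (y k)) (hv₀ : Tendsto v atTop (𝓝 v₀)) :
    A w₀ ∈ tangentCone C (f z) ∧ v₀ ∈ directionalNormalCone C (f z) (A w₀) := by
  have hdir : Tendsto (fun k => (t k)⁻¹ • (y k - f z)) atTop (𝓝 (A w₀)) := by
    have h1 := HasFDerivAt.tendsto_inv_smul_sub hf ht ht0 hw
    have h2 : Tendsto (fun k => (t k)⁻¹ • (y k - f (z + t k • w k))) atTop (𝓝 0) := by
      refine squeeze_zero_norm (fun k => ?_) hc
      rw [norm_smul, norm_inv, Real.norm_of_nonneg (ht _).le, inv_mul_le_iff₀ (ht _), mul_comm]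
      exact hy k
    have h3 := h1.add h2
    rw [add_zero] at h3
    refine h3.congr fun k => ?_
    rw [← smul_add]
    congr 1
    abel
  have hty : ∀ k, f z + t k • (t k)⁻¹ • (y k - f z) = y k := fun k => by
    rw [smul_smul, mul_inv_cancel₀ (ht _).ne', one_smul, add_sub_cancel]
  exact ⟨⟨t, _, ht, ht0, hdir, fun k => by rw [hty]; exact (hv k).1⟩,
    ⟨t, _, v, ht, ht0, hdir, hv₀, fun k => by rw [hty]; exact hv k⟩⟩

/-- Directional multiplier condition for one of two constraint systems, the other one being
metrically subregular, implies an error bound for the combined system. -/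
theorem errorBound_of_directional_multiplier_condition [ProperSpace E] [ProperSpace Y]
    [ProperSpace Z] {F : E → Y} {P : E → Z} {Lam : Set Y}
    {Om : Set Z} {zs : E} (hLam : IsClosed Lam) (hOm : IsClosed Om) (hF : ContDiff ℝ 1 F)
    (hP : ContDiff ℝ 1 P) (hPz : P zs ∈ Om) (hsub : MetricallySubregularAt F Lam zs)
    (hmult : ∀ w : E, w ≠ 0 → fderiv ℝ F zs w ∈ tangentCone Lam (F zs) →
      fderiv ℝ P zs w ∈ tangentCone Om (P zs) → ∀ (μ : Y) (lam : Z),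
      (fderiv ℝ P zs).adjoint lam + (fderiv ℝ F zs).adjoint μ = 0 →
      μ ∈ directionalNormalCone Lam (F zs) (fderiv ℝ F zs w) →
      lam ∈ directionalNormalCone Om (P zs) (fderiv ℝ P zs w) → lam = 0) :
    ∃ κ > 0, ∀ᶠ z in 𝓝 zs, Metric.infDist z {u | F u ∈ Lam ∧ P u ∈ Om} ≤
      κ * (Metric.infDist (F z) Lam + Metric.infDist (P z) Om) := by
  by_contra hnot
  obtain ⟨K, hK, h⟩ := exists_approximate_multipliers_of_not_errorBound hLam hOm hF hP hPz hsub hnot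
  let e : ℕ → ℝ := fun k => 1 / ((k : ℝ) + 1)
  have he : ∀ k, 0 < e k := fun k => Nat.one_div_pos_of_nat
  have he1 : ∀ k, e k ≤ 1 := fun k => by
    simp only [e]
    rw [div_le_one (by positivity)]
    simp
  have he0 : Tendsto e atTop (𝓝 0) := tendsto_one_div_add_atTop_nhds_zero_nat
  choose u p q lam μ hne hu hlam hμ hlam1 hμK hp hq hder using fun k => h (e k) (he k) (he1 k)
  let t : ℕ → ℝ := fun k => ‖u k - zs‖
  have ht : ∀ k, 0 < t k := fun k => norm_pos_iff.2 (sub_ne_zero.2 (hne k))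
  have ht0 : Tendsto t atTop (𝓝 0) :=
    squeeze_zero (fun k => (ht k).le) (fun k => (hu k).le) he0
  let w : ℕ → E := fun k => (t k)⁻¹ • (u k - zs)
  have hw1 : ∀ k, ‖w k‖ = 1 := fun k => by
    simp only [w, t]
    rw [norm_smul, norm_inv, norm_norm, inv_mul_cancel₀ (ht k).ne']
  have htw : ∀ k, zs + t k • w k = u k := fun k => by
    simp only [w]
    rw [smul_smul, mul_inv_cancel₀ (ht k).ne', one_smul, add_sub_cancel]
  -- The bound `K` on the multipliers of `F` gives compactness; unit norms of `w` and `lam` survive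
  -- in the limit and exclude zero.
  obtain ⟨⟨w₀, lam₀, μ₀⟩, -, σ, hσ, hlim⟩ :=
    ((isCompact_closedBall (0 : E) 1).prod ((isCompact_closedBall (0 : Z) 1).prod
      (isCompact_closedBall (0 : Y) K))).tendsto_subseq (x := fun k => (w k, lam k, μ k))
      fun k => ⟨by simp [hw1 k], by simp [hlam1 k], by simpa using hμK k⟩
  have hσt := hσ.tendsto_atTop
  have lw : Tendsto (fun k => w (σ k)) atTop (𝓝 w₀) := (continuous_fst.tendsto _).comp hlim
  have llam : Tendsto (fun k => lam (σ k)) atTop (𝓝 lam₀) :=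
    ((continuous_fst.comp continuous_snd).tendsto _).comp hlim
  have lμ : Tendsto (fun k => μ (σ k)) atTop (𝓝 μ₀) :=
    ((continuous_snd.comp continuous_snd).tendsto _).comp hlim
  have ltσ := ht0.comp hσt
  have leσ := he0.comp hσt
  have lu : Tendsto (fun k => u (σ k)) atTop (𝓝 zs) := by
    have := (ltσ.smul lw).const_add zs
    rw [zero_smul, add_zero] at this
    exact this.congr fun k => htw (σ k)
  have hw₀ : ‖w₀‖ = 1 := tendsto_nhds_unique lw.norm (by simp [hw1])
  have hlam₀ : ‖lam₀‖ = 1 := tendsto_nhds_unique llam.norm (by simp [hlam1])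
  obtain ⟨tF, nF⟩ := mem_directionalNormalCone_of_tendsto
    (hF.differentiable one_ne_zero zs).hasFDerivAt (fun k => ht (σ k)) ltσ lw leσ
    (y := fun k => q (σ k)) (fun k => by rw [htw]; exact hq (σ k)) (fun k => hμ (σ k)) lμ
  obtain ⟨tP, nP⟩ := mem_directionalNormalCone_of_tendsto
    (hP.differentiable one_ne_zero zs).hasFDerivAt (fun k => ht (σ k)) ltσ lw leσ
    (y := fun k => p (σ k)) (fun k => by rw [htw]; exact hp (σ k)) (fun k => hlam (σ k)) llam
  have hzero : (fderiv ℝ P zs).adjoint lam₀ + (fderiv ℝ F zs).adjoint μ₀ = 0 := by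
    have c1 : Tendsto (fun k => (fderiv ℝ P (u (σ k))).adjoint) atTop
        (𝓝 (fderiv ℝ P zs).adjoint) :=
      ((ContinuousLinearMap.adjoint.continuous.comp
        (hP.continuous_fderiv one_ne_zero)).tendsto zs).comp lu
    have c2 : Tendsto (fun k => (fderiv ℝ F (u (σ k))).adjoint) atTop
        (𝓝 (fderiv ℝ F zs).adjoint) :=
      ((ContinuousLinearMap.adjoint.continuous.comp
        (hF.continuous_fderiv one_ne_zero)).tendsto zs).comp lu
    have c3 := (tendsto_clm_apply c1 llam).add (tendsto_clm_apply c2 lμ)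
    refine tendsto_nhds_unique c3 (squeeze_zero_norm (fun k => hder (σ k)) ?_)
    simpa using leσ.const_mul 3
  have := hmult w₀ (by rintro rfl; simp at hw₀) tF tP μ₀ lam₀ hzero nF nP
  rw [this] at hlam₀
  simp at hlam₀

end ErrorBound

/-! ### Conic charts for the complementarity set of one second-order cone -/

section SecondOrderCone

variable {r : ℕ}

section WithLp

variable {α β : Type*} [NormedAddCommGroup α] [NormedSpace ℝ α] [NormedAddCommGroup β]
  [NormedSpace ℝ β]

@[fun_prop]
theorem contDiff_withLp_fst : ContDiff ℝ 1 (fun p : WithLp 2 (α × β) => p.fst) :=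
  (WithLp.fstL 2 ℝ α β).contDiff

@[fun_prop]
theorem contDiff_withLp_snd : ContDiff ℝ 1 (fun p : WithLp 2 (α × β) => p.snd) :=
  (WithLp.sndL 2 ℝ α β).contDiff

@[fun_prop]
theorem contDiff_toLp_prod : ContDiff ℝ 1 (fun p : α × β => WithLp.toLp 2 p) :=
  (WithLp.prodContinuousLinearEquiv 2 ℝ α β).symm.contDiff

end WithLp

theorem inner_block (x y : Block r) :
    inner ℝ x y = x.fst * y.fst + inner ℝ x.snd y.snd := by
  rw [WithLp.prod_inner_apply]
  simp [mul_comm]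

/-- Cauchy–Schwarz on the second components. It yields self-duality of the cone and, for orthogonal
pairs, complementarity of x₁ - ‖x₂‖ and y₁. -/
theorem mul_sub_norm_le_inner {x y : Block r} (hy : y ∈ secondOrderCone r) :
    (x.fst - ‖x.snd‖) * y.fst ≤ inner ℝ x y := by
  rw [inner_block]
  have h1 := (abs_le.1 (abs_real_inner_le_norm x.snd y.snd)).1
  have h2 : ‖x.snd‖ * ‖y.snd‖ ≤ ‖x.snd‖ * y.fst := by
    gcongr
    exact hy
  linarith

theorem inner_nonneg_of_mem_secondOrderCone {x y : Block r} (hx : x ∈ secondOrderCone r)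
    (hy : y ∈ secondOrderCone r) : 0 ≤ inner ℝ x y :=
  (mul_nonneg (sub_nonneg.2 hx) ((norm_nonneg _).trans hy)).trans (mul_sub_norm_le_inner hy)

theorem isClosed_complementaritySet_secondOrderCone :
    IsClosed (complementaritySet (secondOrderCone r)) := by
  have h1 : Continuous fun p : WithLp 2 (Block r × Block r) => p.fst := by fun_prop
  have h2 : Continuous fun p : WithLp 2 (Block r × Block r) => p.snd := by fun_prop
  have hK : IsClosed (secondOrderCone r) :=
    isClosed_le (f := fun x : Block r => ‖x.snd‖) (g := fun x : Block r => x.fst)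
      (by fun_prop) (by fun_prop)
  exact (hK.preimage h1).inter ((hK.preimage h2).inter
    (isClosed_eq (h1.inner h2) continuous_const))

theorem zero_mem_complementaritySet_secondOrderCone :
    (0 : WithLp 2 (Block r × Block r)) ∈ complementaritySet (secondOrderCone r) := by
  simp [complementaritySet, secondOrderCone]

theorem eq_zero_of_mem_secondOrderCone_of_fst_nonpos {y : Block r} (hy : y ∈ secondOrderCone r)
    (h : y.fst ≤ 0) : y = 0 := by
  have h1 : ‖y.snd‖ ≤ y.fst := hy
  have h2 : y.snd = 0 := norm_le_zero_iff.1 (h1.trans h)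
  have h3 : y.fst = 0 := le_antisymm h ((norm_nonneg _).trans h1)
  rw [WithLp.ext_iff]
  exact Prod.ext h3 h2

/-- Off the axis, the complementarity set is described by the scalar complementarity of the
gap `x₁ - ‖x₂‖` and `y₁`, together with `y₂` being the multiple `-y₁ / ‖x₂‖` of `x₂`. -/
theorem mem_complementaritySet_secondOrderCone_iff {p : WithLp 2 (Block r × Block r)}
    (h0 : p.fst.snd ≠ 0) : p ∈ complementaritySet (secondOrderCone r) ↔
      0 ≤ p.fst.fst - ‖p.fst.snd‖ ∧ 0 ≤ p.snd.fst ∧ (p.fst.fst - ‖p.fst.snd‖) * p.snd.fst = 0 ∧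
        p.snd.snd + (p.snd.fst / ‖p.fst.snd‖) • p.fst.snd = 0 := by
  obtain ⟨x, y⟩ := p
  simp only [WithLp.toLp_fst, WithLp.toLp_snd] at h0 ⊢
  have hn : 0 < ‖x.snd‖ := norm_pos_iff.2 h0
  constructor
  · rintro ⟨hx, hy, hxy⟩
    change x ∈ secondOrderCone r at hx
    change y ∈ secondOrderCone r at hy
    change inner ℝ x y = 0 at hxy
    have hx' : 0 ≤ x.fst - ‖x.snd‖ := sub_nonneg.2 hx
    have hy' : ‖y.snd‖ ≤ y.fst := hy
    have hy0 : 0 ≤ y.fst := (norm_nonneg _).trans hy'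
    have h1 := mul_sub_norm_le_inner (x := x) hy
    rw [hxy] at h1
    have h2 : (x.fst - ‖x.snd‖) * y.fst = 0 := le_antisymm h1 (mul_nonneg hx' hy0)
    refine ⟨hx', hy0, h2, ?_⟩
    rw [inner_block] at hxy
    -- Equality case of Cauchy–Schwarz: once the inner product is inserted, this square equals ‖y₂‖²
    -- - y₁² ≤ 0.
    have h3 : ‖y.snd + (y.fst / ‖x.snd‖) • x.snd‖ ^ 2 =
        ‖y.snd‖ ^ 2 + 2 * (y.fst / ‖x.snd‖) * inner ℝ x.snd y.snd + y.fst ^ 2 := by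
      rw [norm_add_sq_real, inner_smul_right, norm_smul, Real.norm_of_nonneg (by positivity),
        div_mul_cancel₀ _ hn.ne', real_inner_comm]
      ring
    have h4 : inner ℝ x.snd y.snd = -(‖x.snd‖ * y.fst) := by linarith
    have h5 : ‖y.snd‖ ^ 2 ≤ y.fst ^ 2 := by gcongr
    have h6 : ‖y.snd + (y.fst / ‖x.snd‖) • x.snd‖ ^ 2 ≤ 0 := by
      rw [h3, h4]
      have : 2 * (y.fst / ‖x.snd‖) * -(‖x.snd‖ * y.fst) = -2 * y.fst ^ 2 := by
        field_simp
      rw [this]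
      linarith
    have h7 := pow_eq_zero_iff (two_ne_zero) |>.1 (le_antisymm h6 (sq_nonneg _))
    exact norm_eq_zero.1 h7
  · rintro ⟨ha, hb, hab, hq⟩
    have hys : y.snd = -((y.fst / ‖x.snd‖) • x.snd) := eq_neg_of_add_eq_zero_left hq
    refine ⟨sub_nonneg.1 ha, ?_, ?_⟩
    · change ‖y.snd‖ ≤ y.fst
      rw [hys, norm_neg, norm_smul, Real.norm_of_nonneg (by positivity), div_mul_cancel₀ _ hn.ne']
    · change inner ℝ x y = 0
      rw [inner_block, hys, inner_neg_right, inner_smul_right, real_inner_self_eq_norm_sq]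
      have : y.fst / ‖x.snd‖ * ‖x.snd‖ ^ 2 = ‖x.snd‖ * y.fst := by field_simp
      rw [this]
      linarith

theorem hasConicChartAt_of_locallyConicAt {X : Type*} [NormedAddCommGroup X]
    [InnerProductSpace ℝ X] {C D : Set X} {z : X} (hCD : ∀ᶠ x in 𝓝 z, (x ∈ C ↔ x ∈ D))
    (hD : LocallyConicAt D z) : HasConicChartAt C z :=
  ⟨id, id, D, contDiffAt_id, contDiffAt_id, Eventually.of_forall fun _ => rfl,
    Eventually.of_forall fun _ => rfl, hCD, hD⟩

/-- The coordinates a = x₁ - ‖x₂‖, x₂, b = y₁ and y₂ + (y₁/‖x₂‖)x₂ are C¹ where x₂ ≠ 0 and turn the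
set into a, b ≥ 0, ab = 0 with vanishing last coordinate. By `hbd` the base point has a = 0, and
there this set is conic. -/
theorem hasConicChartAt_of_snd_ne_zero {p : WithLp 2 (Block r × Block r)}
    (hp : p ∈ complementaritySet (secondOrderCone r)) (h0 : p.fst.snd ≠ 0)
    (hbd : p.fst.fst = ‖p.fst.snd‖) :
    HasConicChartAt (complementaritySet (secondOrderCone r)) p := by
  let ψ : WithLp 2 (Block r × Block r) → WithLp 2 (Block r × Block r) := fun p =>
    WithLp.toLp 2 (WithLp.toLp 2 (p.fst.fst - ‖p.fst.snd‖, p.fst.snd),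
      WithLp.toLp 2 (p.snd.fst, p.snd.snd + (p.snd.fst / ‖p.fst.snd‖) • p.fst.snd))
  let φ : WithLp 2 (Block r × Block r) → WithLp 2 (Block r × Block r) := fun p =>
    WithLp.toLp 2 (WithLp.toLp 2 (p.fst.fst + ‖p.fst.snd‖, p.fst.snd),
      WithLp.toLp 2 (p.snd.fst, p.snd.snd - (p.snd.fst / ‖p.fst.snd‖) • p.fst.snd))
  let D : Set (WithLp 2 (Block r × Block r)) :=
    {q | 0 ≤ q.fst.fst ∧ 0 ≤ q.snd.fst ∧ q.fst.fst * q.snd.fst = 0 ∧ q.snd.snd = 0}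
  have cx : ∀ {q : WithLp 2 (Block r × Block r)},
      ContDiffAt ℝ 1 (fun p : WithLp 2 (Block r × Block r) => p.fst.snd) q := by
    intro q
    fun_prop
  have cy : ∀ {q : WithLp 2 (Block r × Block r)},
      ContDiffAt ℝ 1 (fun p : WithLp 2 (Block r × Block r) => p.snd.fst) q := by
    intro q
    fun_prop
  have hdivc : ∀ {q : WithLp 2 (Block r × Block r)}, q.fst.snd ≠ 0 → ContDiffAt ℝ 1
      (fun p : WithLp 2 (Block r × Block r) => (p.snd.fst / ‖p.fst.snd‖) • p.fst.snd) q :=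
    fun hq => (cy.div (cx.norm ℝ hq) (norm_ne_zero_iff.2 hq)).smul cx
  refine ⟨ψ, φ, D, ?_, ?_, ?_, ?_, ?_, ?_⟩
  · have := cx.norm ℝ h0
    have := hdivc h0
    simp only [ψ]
    fun_prop
  · have hψ0 : (ψ p).fst.snd ≠ 0 := h0
    have := cx.norm ℝ hψ0
    have := hdivc hψ0
    simp only [φ]
    fun_prop
  -- Both maps are shears that leave x₂ and y₁ unchanged, so they are mutually inverse everywhere,
  -- even at x₂ = 0, where the quotient takes the value 0.
  · refine Eventually.of_forall fun q => ?_
    simp only [φ, ψ, WithLp.toLp_fst, WithLp.toLp_snd, sub_add_cancel, add_sub_cancel_right]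
    rfl
  · refine Eventually.of_forall fun q => ?_
    simp only [φ, ψ, WithLp.toLp_fst, WithLp.toLp_snd, sub_add_cancel, add_sub_cancel_right]
    rfl
  · have : ∀ᶠ q : WithLp 2 (Block r × Block r) in 𝓝 p, q.fst.snd ≠ 0 := by
      have hc : Continuous fun q : WithLp 2 (Block r × Block r) => q.fst.snd := by fun_prop
      exact hc.continuousAt.eventually_ne h0
    filter_upwards [this] with q hq
    exact mem_complementaritySet_secondOrderCone_iff hq
  · have hD := (mem_complementaritySet_secondOrderCone_iff h0).1 hp
    have e1 : (ψ p).fst.fst = 0 := by simp [ψ, hbd]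
    have e2 : (ψ p).snd.snd = 0 := hD.2.2.2
    have e3 : 0 ≤ (ψ p).snd.fst := hD.2.1
    have hmem : ∀ u, ψ p + u ∈ D ↔ 0 ≤ u.fst.fst ∧ 0 ≤ (ψ p).snd.fst + u.snd.fst ∧
        u.fst.fst * ((ψ p).snd.fst + u.snd.fst) = 0 ∧ u.snd.snd = 0 := by
      intro u
      simp [D, e1, e2]
    generalize (ψ p).snd.fst = b at hmem e3
    have hu : ∀ u : WithLp 2 (Block r × Block r), |u.snd.fst| ≤ ‖u‖ := fun u =>
      (WithLp.norm_fst_le _ u.snd).trans (WithLp.norm_snd_le _ u)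
    rcases e3.eq_or_lt with hb | hb
    · refine ⟨1, one_pos, fun u _ t ht _ => ?_⟩
      simp [hmem, ← hb, ht.ne', mul_nonneg_iff_of_pos_left ht]
    -- Within radius `b` the coordinate y₁ stays positive, so complementarity reduces to a = 0.
    · refine ⟨b, hb, fun u hub t ht ht1 => ?_⟩
      have h1 : 0 < b + u.snd.fst := by
        have := (abs_le.1 (hu u)).1
        linarith
      have h2 : 0 < b + t * u.snd.fst := by
        have := (abs_le.1 (hu u)).1
        nlinarith
      simp [hmem, ht.ne', mul_nonneg_iff_of_pos_left ht, h1.le, h1.ne', h2.le, h2.ne']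

/-- When x is interior, orthogonality forces y = 0, so the set is locally a linear subspace and no
change of coordinates is needed. -/
theorem hasConicChartAt_of_norm_lt {p : WithLp 2 (Block r × Block r)}
    (hp : p ∈ complementaritySet (secondOrderCone r)) (h0 : ‖p.fst.snd‖ < p.fst.fst) :
    HasConicChartAt (complementaritySet (secondOrderCone r)) p := by
  have key : ∀ q : WithLp 2 (Block r × Block r), ‖q.fst.snd‖ < q.fst.fst →
      (q ∈ complementaritySet (secondOrderCone r) ↔ q.snd = 0) := by
    intro q hq
    constructor
    · rintro ⟨-, hy, hxy⟩
      have h1 := mul_sub_norm_le_inner (x := q.fst) hy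
      rw [hxy] at h1
      exact eq_zero_of_mem_secondOrderCone_of_fst_nonpos hy
        (nonpos_of_mul_nonpos_right h1 (sub_pos.2 hq))
    · intro hy
      exact ⟨hq.le, by simp [hy, secondOrderCone], by simp [hy]⟩
  refine hasConicChartAt_of_locallyConicAt (D := {q | q.snd = 0}) ?_ ?_
  · have : ∀ᶠ q : WithLp 2 (Block r × Block r) in 𝓝 p, ‖q.fst.snd‖ < q.fst.fst := by
      have h1 : Continuous fun q : WithLp 2 (Block r × Block r) => ‖q.fst.snd‖ := by fun_prop
      have h2 : Continuous fun q : WithLp 2 (Block r × Block r) => q.fst.fst := by fun_prop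
      exact h1.continuousAt.eventually_lt h2.continuousAt h0
    filter_upwards [this] with q hq using key q hq
  · have hy : p.snd = 0 := (key p h0).1 hp
    refine ⟨1, one_pos, fun u _ t ht _ => ?_⟩
    simp [hy, ht.ne']

theorem hasConicChartAt_zero :
    HasConicChartAt (complementaritySet (secondOrderCone r)) 0 := by
  refine hasConicChartAt_of_locallyConicAt (Eventually.of_forall fun _ => Iff.rfl)
    ⟨1, one_pos, fun u _ t ht _ => ?_⟩
  have h1 : ∀ x : Block r, t • x ∈ secondOrderCone r ↔ x ∈ secondOrderCone r := fun x => by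
    simp [secondOrderCone, norm_smul, abs_of_pos ht, ht]
  have h2 : inner ℝ (t • u.fst) (t • u.snd) = 0 ↔ inner ℝ u.fst u.snd = 0 := by
    rw [inner_smul_left, inner_smul_right]
    simp [ht.ne']
  rw [zero_add, zero_add]
  exact and_congr (h1 _).symm (and_congr (h1 _).symm h2.symm)

theorem HasConicChartAt.preimage_equiv {X : Type*} [NormedAddCommGroup X]
    [InnerProductSpace ℝ X] {C : Set X} {z : X} (e : X ≃L[ℝ] X)
    (h : HasConicChartAt C (e z)) : HasConicChartAt (e ⁻¹' C) z := by
  obtain ⟨ψ, φ, D, h1, h2, h3, h4, h5, h6⟩ := h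
  have he : Tendsto e (𝓝 z) (𝓝 (e z)) := e.continuous.tendsto z
  refine ⟨ψ ∘ e, e.symm ∘ φ, D, h1.comp z e.contDiff.contDiffAt,
    e.symm.contDiff.contDiffAt.comp _ h2, ?_, ?_, he.eventually h5, h6⟩
  · filter_upwards [he.eventually h3] with x hx
    simp [hx]
  · filter_upwards [h4] with y hy
    simpa using hy

/-- If x is interior or a nonzero boundary point, the charts above apply directly. If x = 0,
swapping x and y reduces to the same cases for y, leaving only the origin, where the set is itself a
cone. -/
theorem hasConicChartAt_complementaritySet {p : WithLp 2 (Block r × Block r)}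
    (hp : p ∈ complementaritySet (secondOrderCone r)) :
    HasConicChartAt (complementaritySet (secondOrderCone r)) p := by
  let e : WithLp 2 (Block r × Block r) ≃L[ℝ] WithLp 2 (Block r × Block r) :=
    ((WithLp.prodContinuousLinearEquiv 2 ℝ (Block r) (Block r)).trans
      (ContinuousLinearEquiv.prodComm ℝ (Block r) (Block r))).trans
      (WithLp.prodContinuousLinearEquiv 2 ℝ (Block r) (Block r)).symm
  have he : ∀ q, e q = WithLp.toLp 2 (q.snd, q.fst) := fun q => rfl
  have hpre : e ⁻¹' (complementaritySet (secondOrderCone r)) =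
      complementaritySet (secondOrderCone r) := by
    ext q
    simp only [Set.mem_preimage, he, complementaritySet, Set.mem_ofPred_eq, WithLp.toLp_fst,
      WithLp.toLp_snd, real_inner_comm]
    tauto
  have hswap : HasConicChartAt (complementaritySet (secondOrderCone r)) (e p) →
      HasConicChartAt (complementaritySet (secondOrderCone r)) p := fun h => by
    have := h.preimage_equiv e
    rwa [hpre] at this
  have hep : e p ∈ complementaritySet (secondOrderCone r) := by
    rw [← hpre] at hp
    exact hp
  rcases lt_or_eq_of_le (show ‖p.fst.snd‖ ≤ p.fst.fst from hp.1) with h1 | h1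
  · exact hasConicChartAt_of_norm_lt hp h1
  by_cases h2 : p.fst.snd = 0
  · rcases lt_or_eq_of_le (show ‖p.snd.snd‖ ≤ p.snd.fst from hp.2.1) with h3 | h3
    · exact hswap (hasConicChartAt_of_norm_lt hep h3)
    by_cases h4 : p.snd.snd = 0
    · rw [h2, norm_zero] at h1
      rw [h4, norm_zero] at h3
      have e1 := eq_zero_of_mem_secondOrderCone_of_fst_nonpos hp.1 h1.symm.le
      have e2 := eq_zero_of_mem_secondOrderCone_of_fst_nonpos hp.2.1 h3.symm.le
      have : p = 0 := by
        rw [WithLp.ext_iff]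
        exact Prod.ext e1 e2
      rw [this]
      exact hasConicChartAt_zero
    · exact hswap (hasConicChartAt_of_snd_ne_zero hep h4 h3.symm)
  · exact hasConicChartAt_of_snd_ne_zero hp h2 h1.symm

end SecondOrderCone

/-! ### Blockwise description of Ω, its normals and its tangents -/

section Product

variable {J : ℕ} {r : Fin J → ℕ}

/-- The pair of `i`-th blocks of a pair of block vectors. -/
noncomputable def blockPair (r : Fin J → ℕ) (i : Fin J) :
    WithLp 2 (BlockSpace r × BlockSpace r) →L[ℝ] WithLp 2 (Block (r i) × Block (r i)) :=
  (WithLp.prodContinuousLinearEquiv 2 ℝ (Block (r i)) (Block (r i))).symm.toContinuousLinearMap.comp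
    (((PiLp.proj 2 (fun i => Block (r i)) i).comp (WithLp.fstL 2 ℝ _ _)).prod
      ((PiLp.proj 2 (fun i => Block (r i)) i).comp (WithLp.sndL 2 ℝ _ _)))

theorem blockPair_apply (i : Fin J) (p : WithLp 2 (BlockSpace r × BlockSpace r)) :
    blockPair r i p = WithLp.toLp 2 (p.fst i, p.snd i) := rfl

/-- The pair of block vectors with given pairs of blocks. -/
def ofBlockPairs (q : ∀ i, WithLp 2 (Block (r i) × Block (r i))) :
    WithLp 2 (BlockSpace r × BlockSpace r) :=
  WithLp.toLp 2 (WithLp.toLp 2 fun i => (q i).fst, WithLp.toLp 2 fun i => (q i).snd)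

theorem blockPair_ofBlockPairs (q : ∀ i, WithLp 2 (Block (r i) × Block (r i))) (i : Fin J) :
    blockPair r i (ofBlockPairs q) = q i := rfl

theorem continuous_ofBlockPairs : Continuous (ofBlockPairs (r := r)) := by
  unfold ofBlockPairs
  fun_prop

theorem inner_eq_sum_blockPair (p q : WithLp 2 (BlockSpace r × BlockSpace r)) :
    inner ℝ p q = ∑ i, inner ℝ (blockPair r i p) (blockPair r i q) := by
  simp only [WithLp.prod_inner_apply, PiLp.inner_apply, blockPair_apply, ← Finset.sum_add_distrib]
  rfl

theorem norm_sq_eq_sum_blockPair (p : WithLp 2 (BlockSpace r × BlockSpace r)) :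
    ‖p‖ ^ 2 = ∑ i, ‖blockPair r i p‖ ^ 2 := by
  simp only [← real_inner_self_eq_norm_sq]
  exact inner_eq_sum_blockPair p p

theorem norm_blockPair_le (i : Fin J) (p : WithLp 2 (BlockSpace r × BlockSpace r)) :
    ‖blockPair r i p‖ ≤ ‖p‖ := by
  refine le_of_sq_le_sq ?_ (norm_nonneg _)
  rw [norm_sq_eq_sum_blockPair p]
  exact Finset.single_le_sum (f := fun i => ‖blockPair r i p‖ ^ 2) (fun _ _ => sq_nonneg _)
    (Finset.mem_univ i)

theorem norm_le_sum_blockPair (p : WithLp 2 (BlockSpace r × BlockSpace r)) :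
    ‖p‖ ≤ ∑ i, ‖blockPair r i p‖ := by
  refine le_of_sq_le_sq ?_ (Finset.sum_nonneg fun _ _ => norm_nonneg _)
  rw [norm_sq_eq_sum_blockPair p]
  exact Finset.sum_sq_le_sq_sum_of_nonneg fun _ _ => norm_nonneg _

theorem blockPair_adjoint_apply (i : Fin J) (x : WithLp 2 (Block (r i) × Block (r i))) :
    (blockPair r i).adjoint x = ofBlockPairs (Pi.single i x) := by
  refine ext_inner_right ℝ fun v => ?_
  rw [ContinuousLinearMap.adjoint_inner_left, inner_eq_sum_blockPair,
    Finset.sum_eq_single_of_mem i (Finset.mem_univ i)]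
  · rw [blockPair_ofBlockPairs, Pi.single_eq_same]
  · intro j _ hj
    rw [blockPair_ofBlockPairs, Pi.single_eq_of_ne hj, inner_zero_left]

/-- By self-duality the blockwise inner products are nonnegative, so a zero sum forces each of them
to vanish. -/
theorem mem_complementaritySet_productCone_iff {p : WithLp 2 (BlockSpace r × BlockSpace r)} :
    p ∈ complementaritySet (productCone r) ↔
      ∀ i, blockPair r i p ∈ complementaritySet (secondOrderCone (r i)) := by
  constructor
  · rintro ⟨hx, hy, hxy⟩ i
    refine ⟨hx i, hy i, ?_⟩
    rw [PiLp.inner_apply] at hxy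
    exact (Finset.sum_eq_zero_iff_of_nonneg fun j _ =>
      inner_nonneg_of_mem_secondOrderCone (hx j) (hy j)).1 hxy i (Finset.mem_univ i)
  · intro h
    refine ⟨fun i => (h i).1, fun i => (h i).2.1, ?_⟩
    rw [PiLp.inner_apply]
    exact Finset.sum_eq_zero fun i _ => (h i).2.2

theorem isClosed_complementaritySet_productCone :
    IsClosed (complementaritySet (productCone r)) := by
  have : complementaritySet (productCone r) =
      ⋂ i, blockPair r i ⁻¹' complementaritySet (secondOrderCone (r i)) := by
    ext p
    rw [mem_complementaritySet_productCone_iff, Set.mem_iInter]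
    rfl
  rw [this]
  exact isClosed_iInter fun i =>
    isClosed_complementaritySet_secondOrderCone.preimage (blockPair r i).continuous

theorem infDist_complementaritySet_productCone_le (p : WithLp 2 (BlockSpace r × BlockSpace r)) :
    Metric.infDist p (complementaritySet (productCone r)) ≤
      ∑ i, Metric.infDist (blockPair r i p) (complementaritySet (secondOrderCone (r i))) := by
  choose q hq hd using fun i => (isClosed_complementaritySet_secondOrderCone
    (r := r i)).exists_infDist_eq_dist ⟨0, zero_mem_complementaritySet_secondOrderCone⟩
      (blockPair r i p)
  calc _ ≤ dist p (ofBlockPairs q) := Metric.infDist_le_dist_of_mem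
        (mem_complementaritySet_productCone_iff.2 hq)
    _ ≤ ∑ i, ‖blockPair r i (p - ofBlockPairs q)‖ := by
        rw [dist_eq_norm]
        exact norm_le_sum_blockPair _
    _ = _ := Finset.sum_congr rfl fun i _ => by
        rw [hd i, dist_eq_norm, map_sub, blockPair_ofBlockPairs]

theorem mem_regularNormalCone_productCone_iff {p v : WithLp 2 (BlockSpace r × BlockSpace r)} :
    v ∈ regularNormalCone (complementaritySet (productCone r)) p ↔ ∀ i, blockPair r i v ∈
      regularNormalCone (complementaritySet (secondOrderCone (r i))) (blockPair r i p) := by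
  constructor
  · intro hv i
    have hp := mem_complementaritySet_productCone_iff.1 hv.1
    -- Varying one block while freezing the others at `p` embeds Ω_i in Ω; pulling `v` back along
    -- this map extracts its `i`-th block.
    let ψ : WithLp 2 (Block (r i) × Block (r i)) → WithLp 2 (BlockSpace r × BlockSpace r) :=
      fun x => p + (blockPair r i).adjoint (x - blockPair r i p)
    have hψ : HasFDerivAt ψ (blockPair r i).adjoint (blockPair r i p) :=
      ((blockPair r i).adjoint.hasFDerivAt.comp _
        ((hasFDerivAt_id _).sub_const _)).const_add p
    have hψp : ψ (blockPair r i p) = p := by simp [ψ]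
    have := adjoint_mem_regularNormalCone hψ (hp i)
      (D := complementaritySet (productCone r)) (w := v) ?_ (by rwa [hψp])
    · rwa [ContinuousLinearMap.adjoint_adjoint] at this
    · refine Eventually.of_forall fun x hx => mem_complementaritySet_productCone_iff.2 fun j => ?_
      simp only [ψ]
      rw [blockPair_adjoint_apply, map_add, blockPair_ofBlockPairs]
      by_cases hj : j = i
      · subst hj
        rwa [Pi.single_eq_same, add_sub_cancel]
      · rw [Pi.single_eq_of_ne hj, add_zero]
        exact hp j
  · intro h
    refine ⟨mem_complementaritySet_productCone_iff.2 fun i => (h i).1, fun ε hε => ?_⟩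
    have key : ∀ i, ∀ᶠ p' in 𝓝[complementaritySet (productCone r)] p,
        -- The denominator `J + 1` lets the `J` bounds add up to at most ε and covers `J = 0`.
        inner ℝ (blockPair r i v) (blockPair r i (p' - p)) ≤ ε / (J + 1) * ‖p' - p‖ := by
      intro i
      have ht : Tendsto (blockPair r i) (𝓝[complementaritySet (productCone r)] p)
          (𝓝[complementaritySet (secondOrderCone (r i))] (blockPair r i p)) :=
        tendsto_nhdsWithin_iff.2
          ⟨((blockPair r i).continuous.tendsto p).mono_left nhdsWithin_le_nhds, by
            filter_upwards [self_mem_nhdsWithin] with p' hp'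
            exact mem_complementaritySet_productCone_iff.1 hp' i⟩
      filter_upwards [ht.eventually ((h i).2 (ε / (J + 1)) (by positivity))] with p' hp'
      rw [map_sub]
      refine hp'.trans ?_
      rw [← map_sub]
      gcongr
      exact norm_blockPair_le i _
    filter_upwards [eventually_all.2 key] with p' hp'
    rw [inner_eq_sum_blockPair]
    refine (Finset.sum_le_sum fun i _ => hp' i).trans ?_
    rw [Finset.sum_const, Finset.card_univ, Fintype.card_fin, nsmul_eq_mul]
    calc (J : ℝ) * (ε / (J + 1) * ‖p' - p‖) = (J / (J + 1)) * (ε * ‖p' - p‖) := by ring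
      _ ≤ 1 * (ε * ‖p' - p‖) := by
        gcongr
        rw [div_le_one (by positivity)]
        linarith
      _ = _ := one_mul _

/-- A step sequence for the product serves every block. Conversely, the conic charts allow all
blocks to use the steps 1/(k+1), so their sequences can be assembled. -/
theorem mem_directionalNormalCone_productCone_iff
    {p d v : WithLp 2 (BlockSpace r × BlockSpace r)}
    (hp : p ∈ complementaritySet (productCone r)) :
    v ∈ directionalNormalCone (complementaritySet (productCone r)) p d ↔
      ∀ i, blockPair r i v ∈ directionalNormalCone (complementaritySet (secondOrderCone (r i)))
        (blockPair r i p) (blockPair r i d) := by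
  constructor
  · rintro ⟨t, dk, vk, ht, ht0, hd, hv, hN⟩ i
    refine ⟨t, fun k => blockPair r i (dk k), fun k => blockPair r i (vk k), ht, ht0,
      ((blockPair r i).continuous.tendsto d).comp hd,
      ((blockPair r i).continuous.tendsto v).comp hv, fun k => ?_⟩
    have := mem_regularNormalCone_productCone_iff.1 (hN k) i
    rwa [map_add, map_smul] at this
  · intro h
    have hs : ∀ k : ℕ, (0 : ℝ) < 1 / ((k : ℝ) + 1) := fun k => Nat.one_div_pos_of_nat
    have hs0 := tendsto_one_div_add_atTop_nhds_zero_nat (𝕜 := ℝ)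
    choose dk vk hd hv hN using fun i =>
      (hasConicChartAt_complementaritySet
        (mem_complementaritySet_productCone_iff.1 hp i)).directionallyUniformAt _ _ (h i) _ hs hs0
    -- Normality holds only from some index on, whereas the definition asks for every index; the
    -- sequences are therefore shifted by `N`.
    obtain ⟨N, hN⟩ := eventually_atTop.1 (eventually_all.2 hN)
    have hshift : Tendsto (fun k : ℕ => k + N) atTop atTop := tendsto_add_atTop_nat N
    refine ⟨fun k => 1 / (((k + N : ℕ) : ℝ) + 1), fun k => ofBlockPairs fun i => dk i (k + N),
      fun k => ofBlockPairs fun i => vk i (k + N), fun k => hs (k + N), hs0.comp hshift,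
      ?_, ?_, fun k => ?_⟩
    · exact (continuous_ofBlockPairs.tendsto _).comp
        (tendsto_pi_nhds.2 fun i => (hd i).comp hshift)
    · exact (continuous_ofBlockPairs.tendsto _).comp
        (tendsto_pi_nhds.2 fun i => (hv i).comp hshift)
    · refine mem_regularNormalCone_productCone_iff.2 fun i => ?_
      rw [map_add, map_smul]
      exact hN (k + N) (Nat.le_add_left N k) i

theorem mem_tangentCone_productCone_iff {p d : WithLp 2 (BlockSpace r × BlockSpace r)}
    (hp : p ∈ complementaritySet (productCone r)) :
    d ∈ tangentCone (complementaritySet (productCone r)) p ↔ ∀ i, blockPair r i d ∈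
      tangentCone (complementaritySet (secondOrderCone (r i))) (blockPair r i p) := by
  simp only [mem_tangentCone_iff_zero_mem_directionalNormalCone,
    mem_directionalNormalCone_productCone_iff hp, map_zero]

end Product

/-! ### Transfer to the complementarity system -/

section Problem

variable {n l J : ℕ} {r : Fin J → ℕ}

theorem fderiv_block_apply {G : EuclideanSpace ℝ (Fin n) → BlockSpace r}
    {zs : EuclideanSpace ℝ (Fin n)} (hG : DifferentiableAt ℝ G zs) (i : Fin J) :
    fderiv ℝ (fun z => G z i) zs = (PiLp.proj 2 (fun i => Block (r i)) i).comp (fderiv ℝ G zs) :=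
  (((PiLp.proj (𝕜 := ℝ) 2 (fun i => Block (r i)) i).hasFDerivAt).comp zs hG.hasFDerivAt).fderiv

theorem adjoint_fderiv_eq_sum {G : EuclideanSpace ℝ (Fin n) → BlockSpace r}
    {zs : EuclideanSpace ℝ (Fin n)} (hG : DifferentiableAt ℝ G zs) (lam : BlockSpace r) :
    (fderiv ℝ G zs).adjoint lam = ∑ i, (fderiv ℝ (fun z => G z i) zs).adjoint (lam i) := by
  refine ext_inner_right ℝ fun v => ?_
  rw [ContinuousLinearMap.adjoint_inner_left, PiLp.inner_apply, sum_inner]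
  refine Finset.sum_congr rfl fun i _ => ?_
  rw [ContinuousLinearMap.adjoint_inner_left, fderiv_block_apply hG]
  rfl

theorem hasFDerivAt_toLp_prod {G H : EuclideanSpace ℝ (Fin n) → BlockSpace r}
    {zs : EuclideanSpace ℝ (Fin n)} (hG : DifferentiableAt ℝ G zs) (hH : DifferentiableAt ℝ H zs) :
    HasFDerivAt (fun z => WithLp.toLp 2 (G z, H z))
      ((WithLp.prodContinuousLinearEquiv 2 ℝ _ _).symm.toContinuousLinearMap.comp
        ((fderiv ℝ G zs).prod (fderiv ℝ H zs))) zs :=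
  ((WithLp.prodContinuousLinearEquiv 2 ℝ (BlockSpace r)
    (BlockSpace r)).symm.toContinuousLinearMap.hasFDerivAt).comp zs
      (hG.hasFDerivAt.prodMk hH.hasFDerivAt)

theorem toLp_mem_complementaritySet_of_mem_solutionSet
    {G H : EuclideanSpace ℝ (Fin n) → BlockSpace r}
    {F : EuclideanSpace ℝ (Fin n) → EuclideanSpace ℝ (Fin l)}
    {Lam : Set (EuclideanSpace ℝ (Fin l))} {z : EuclideanSpace ℝ (Fin n)}
    (hz : z ∈ solutionSet G H F Lam) :
    WithLp.toLp 2 (G z, H z) ∈ complementaritySet (productCone r) :=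
  ⟨hz.1, hz.2.1, hz.2.2.1⟩

/-- The blockwise and the joint directional multiplier conditions are equivalent. -/
theorem componentwiseMultiplierCondition_iff_joint
    {G H : EuclideanSpace ℝ (Fin n) → BlockSpace r}
    {F : EuclideanSpace ℝ (Fin n) → EuclideanSpace ℝ (Fin l)}
    {Lam : Set (EuclideanSpace ℝ (Fin l))} {zs : EuclideanSpace ℝ (Fin n)}
    (hG : DifferentiableAt ℝ G zs) (hH : DifferentiableAt ℝ H zs)
    (hzs : zs ∈ solutionSet G H F Lam) :
    ComponentwiseMultiplierCondition G H F Lam zs ↔ JointMultiplierCondition G H F Lam zs := by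
  have hp := toLp_mem_complementaritySet_of_mem_solutionSet hzs
  have hd : ∀ w i, (WithLp.toLp 2 (fderiv ℝ (fun z => G z i) zs w,
      fderiv ℝ (fun z => H z i) zs w) : WithLp 2 (Block (r i) × Block (r i))) =
      blockPair r i (WithLp.toLp 2 (fderiv ℝ G zs w, fderiv ℝ H zs w)) := by
    intro w i
    rw [fderiv_block_apply hG, fderiv_block_apply hH]
    rfl
  have hsum : ∀ (lamF : EuclideanSpace ℝ (Fin l)) (lamG lamH : BlockSpace r),
      (fderiv ℝ F zs).adjoint lamF + ∑ i, ((fderiv ℝ (fun z => G z i) zs).adjoint (lamG i) +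
        (fderiv ℝ (fun z => H z i) zs).adjoint (lamH i)) =
      (fderiv ℝ F zs).adjoint lamF + (fderiv ℝ G zs).adjoint lamG +
        (fderiv ℝ H zs).adjoint lamH := by
    intro lamF lamG lamH
    rw [Finset.sum_add_distrib, ← adjoint_fderiv_eq_sum hG, ← adjoint_fderiv_eq_sum hH, add_assoc]
  unfold ComponentwiseMultiplierCondition JointMultiplierCondition
  refine forall_congr' fun w => imp_congr_right fun _ => imp_congr_right fun _ => ?_
  refine imp_congr ?_ (forall_congr' fun lamF => forall_congr' fun lamG => forall_congr' fun lamH =>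
    imp_congr (by rw [hsum]) (imp_congr_right fun _ => imp_congr_left ?_))
  · rw [mem_tangentCone_productCone_iff hp]
    refine forall_congr' fun i => ?_
    rw [hd]
    rfl
  · rw [mem_directionalNormalCone_productCone_iff hp]
    refine forall_congr' fun i => ?_
    rw [hd]
    rfl

/-- The joint directional multiplier condition and metric subregularity of the constraint
`F z ∈ Λ` imply a local error bound. -/
theorem hasLocalErrorBoundAt_of_jointMultiplierCondition
    {G H : EuclideanSpace ℝ (Fin n) → BlockSpace r}
    {F : EuclideanSpace ℝ (Fin n) → EuclideanSpace ℝ (Fin l)}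
    {Lam : Set (EuclideanSpace ℝ (Fin l))} {zs : EuclideanSpace ℝ (Fin n)} (hLam : IsClosed Lam)
    (hF : ContDiff ℝ 1 F) (hG : ContDiff ℝ 1 G) (hH : ContDiff ℝ 1 H)
    (hzs : zs ∈ solutionSet G H F Lam) (hsub : MetricallySubregularAt F Lam zs)
    (h : JointMultiplierCondition G H F Lam zs) : HasLocalErrorBoundAt G H F Lam zs := by
  have hGd := hG.differentiable one_ne_zero zs
  have hHd := hH.differentiable one_ne_zero zs
  have hPd := (hasFDerivAt_toLp_prod hGd hHd).fderiv
  have hP : ContDiff ℝ 1 fun z => WithLp.toLp 2 (G z, H z) := by fun_prop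
  have hPw : ∀ w, fderiv ℝ (fun z => WithLp.toLp 2 (G z, H z)) zs w =
      WithLp.toLp 2 (fderiv ℝ G zs w, fderiv ℝ H zs w) := fun w => by rw [hPd]; rfl
  have hadj : ∀ lam, (fderiv ℝ (fun z => WithLp.toLp 2 (G z, H z)) zs).adjoint lam =
      (fderiv ℝ G zs).adjoint lam.fst + (fderiv ℝ H zs).adjoint lam.snd := fun lam => by
    refine ext_inner_right ℝ fun v => ?_
    rw [ContinuousLinearMap.adjoint_inner_left, hPw, inner_add_left,
      ContinuousLinearMap.adjoint_inner_left, ContinuousLinearMap.adjoint_inner_left,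
      WithLp.prod_inner_apply]
    rfl
  obtain ⟨κ, hκ, hb⟩ := errorBound_of_directional_multiplier_condition hLam
    isClosed_complementaritySet_productCone hF hP
    (toLp_mem_complementaritySet_of_mem_solutionSet hzs) hsub (by
      intro w hw hFw hPT μ lam h0 hμ hlam
      rw [hPw] at hPT hlam
      rw [hadj] at h0
      obtain ⟨h1, h2⟩ := h w hw hFw hPT μ lam.fst lam.snd
        (by rw [← h0]; abel) hμ hlam
      rw [WithLp.ext_iff]
      exact Prod.ext h1 h2)
  have hset : {u | F u ∈ Lam ∧ WithLp.toLp 2 (G u, H u) ∈ complementaritySet (productCone r)} =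
      solutionSet G H F Lam := by
    ext u
    exact ⟨fun hu => ⟨hu.2.1, hu.2.2.1, hu.2.2.2, hu.1⟩,
      fun hu => ⟨hu.2.2.2, hu.1, hu.2.1, hu.2.2.1⟩⟩
  rw [hset] at hb
  refine ⟨hzs, κ, hκ, ?_⟩
  filter_upwards [hb] with z hz
  refine hz.trans ?_
  gcongr
  -- The abstract bound involves the distance to Ω; blockwise projections dominate it by the sum of
  -- the distances to the Ω_i.
  exact infDist_complementaritySet_productCone_le _

end Problem

end SOCCP

theorem mainTheorem3 {n l J : ℕ} (r : Fin J → ℕ)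
    (F : EuclideanSpace ℝ (Fin n) → EuclideanSpace ℝ (Fin l))
    (G H : EuclideanSpace ℝ (Fin n) → SOCCP.BlockSpace r)
    (Lam : Set (EuclideanSpace ℝ (Fin l))) (hLam : IsClosed Lam)
    (hF : ContDiff ℝ 1 F) (hG : ContDiff ℝ 1 G) (hH : ContDiff ℝ 1 H)
    (zs : EuclideanSpace ℝ (Fin n)) (hzs : zs ∈ SOCCP.solutionSet G H F Lam) :
    (SOCCP.ComponentwiseMultiplierCondition G H F Lam zs ↔
      SOCCP.JointMultiplierCondition G H F Lam zs) ∧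
    (SOCCP.MetricallySubregularAt F Lam zs →
      SOCCP.ComponentwiseMultiplierCondition G H F Lam zs →
      SOCCP.HasLocalErrorBoundAt G H F Lam zs) := by
  have hiff := SOCCP.componentwiseMultiplierCondition_iff_joint (F := F) (Lam := Lam)
    (hG.differentiable one_ne_zero zs) (hH.differentiable one_ne_zero zs) hzs
  exact ⟨hiff, fun hsub hA => SOCCP.hasLocalErrorBoundAt_of_jointMultiplierCondition hLam hF hG hH
    hzs hsub (hiff.1 hA)⟩
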